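/- **Setting.** Let $\mathbb{E}$ be a finite-dimensional real vector space with the Euclidean norm $\|h\|=\langle Bh,h\rangle^{1/2}$, $B=B^*\succ 0$, and let $\|\cdot\|_*$ be the dual norm on $\mathbb{E}^*$. Let $\psi:\mathbb{E}\to\mathbb{R}\cup\{+\infty\}$ be a closed convex proper function with $Q=\mathrm{dom}\,\psi$. Let $f$ be convex on $Q$, three times continuously differentiable at the points of $Q$, and Quasi-Self-Concordant with parameter $M>0$: $D^3f(x)[u,u,v]\le M\langle\nabla^2f(x)u,u\rangle\|v\|$ for all $x\in Q$ and $u,v\in\mathbb{E}$. Let $x^\star\in Q$ be a minimizer of $F=f+\psi$ over $Q$ and $F^\star=F(x^\star)$. Let $x_0\in Q$ satisfy $F(x_0)>F^\star$ and $\partial F(x_0)\neq\emptyset$. **Dual Newton Method** $\mathscr{D}(f,\psi,x_0,M,\nu)$. Set $g_0=\|F'(x_0)\|_*$ for some $F'(x_0)\in\partial F(x_0)$. For $k\ge0$: set $z_0=x_k$; for $t\ge 0$ compute $$z_{t+1}=\arg\min_{y\in Q}\Bigl\{\langle\nabla f(z_t),y-z_t\rangle+\tfrac12\langle\nabla^2f(z_t)(y-z_t),y-z_t\rangle+Mg_k\|y-x_k\|^2+\psi(y)\Bigr\},$$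 $$s_{t+1}=\nabla f(z_{t+1})-\nabla f(z_t)-\nabla^2f(z_t)(z_{t+1}-z_t),$$ until $\|s_{t+1}\|_*\le 2Mg_k\nu/(k+1)^2$; set $x_{k+1}=z_{t+1}$ and $g_{k+1}=\|s_{t+1}-2Mg_kB(x_{k+1}-x_k)\|_*$; if $g_{k+1}\le\nu$, return $x_{k+1}$. Its number of iterations is the number of executed values of $k$. **Accelerated Newton Scheme.** Given $R,A_0>0$ and $\gamma\in(0,1)$, set $v_0=x_0$. For $k\ge0$: set $A_{k+1}=\frac{A_k}{1-\gamma}$, $a_{k+1}=\frac{\gamma}{1-\gamma}A_k$, $\nu_{k+1}=\frac{R}{(k+1)^2}$, $\bar f_k(x)=A_{k+1}f(\gamma x+(1-\gamma)x_k)$, $\bar\psi_k(x)=a_{k+1}\psi(x)+\frac12\|x-v_k\|^2$; compute $v_{k+1}=\mathscr{D}(\bar f_k,\bar\psi_k,v_k,\gamma M,\nu_{k+1})$, and set $x_{k+1}=\gamma v_{k+1}+(1-\gamma)x_k$. Let $I_{k+1}$ be the number of iterations of the Dual Newton Method in this call. **Theorem.** For every $c>0$ there is a constant $C>0$ depending only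 on $c$ such that the following holds in the above setting whenever $$R\ge\max\Bigl\{\|x_0-x^\star\|,\frac{2^{3/2}}{M}\Bigr\},\qquad A_0=\frac{c^2R^2}{2(F(x_0)-F^\star)},\qquad\gamma=\frac1{(MR)^{2/3}}.$$ 1. The Accelerated Newton Scheme is well defined: at every iteration $k$ the set $\partial(\bar f_k+\bar\psi_k)(v_k)$ is nonempty, and for each choice of the initial subgradient in it the inner call terminates, with a unique returned point and number of iterations. 2. For every run of the scheme (with any choice of these subgradients) and every $0<\varepsilon\le 1/e$, let $k$ be the first index such that $F(x_k)-F^\star\le\varepsilon\,(F(x_0)-F^\star)$. This $k$ exists and $$k\le C\,(MR)^{2/3}\ln\frac1\varepsilon .$$ 3. If moreover the suprema below are finite, then $$\sum_{i=1}^kI_i\le C\,(MR)^{2/3}\ln\frac1\varepsilon\cdot\mathcal{L},\qquad \mathcal{L}=\ln\Bigl[\frac{(MR)^{2/3}R}{F(x_0)-F^\star}\bigl(\sqrt{L_{f,1}\mathcal{F}_0}+L_{\psi,0}\bigr)\frac1\varepsilon\ln^2\frac1\varepsilon\Bigr],$$ where, over all $x\in Q$ with $\|x-x^\star\|\le(5+c)R$,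 $L_{f,1}$ is the supremum of $\|\nabla^2f(x)\|$, $L_{\psi,0}$ is the supremum of $\|\psi'(x)\|_*$ over all $\psi'(x)\in\partial\psi(x)$, and $\mathcal{F}_0$ is the supremum of $F(x)-F^\star$. -/

import Mathlib

open Set

universe u

noncomputable section

namespace QSCNewton

/-! The space `E` with its norm `‖h‖ = ⟨B h, h⟩ ^ (1/2)` is a finite-dimensional real inner product
space; its dual is `E →L[ℝ] ℝ` with the operator norm, and `B = innerSL ℝ : E → E*`.

An extended-valued function `ψ : E → ℝ ∪ {+∞}` is given by its effective domain `Q` and its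
(real) values on `Q`; the values of the Lean function outside `Q` are never used. -/

variable {E : Type u} [NormedAddCommGroup E] [InnerProductSpace ℝ E]

/-- The Hessian `∇²f(x) : E → E*`. -/
def hess (f : E → ℝ) (x : E) : E →L[ℝ] E →L[ℝ] ℝ :=
  fderiv ℝ (fderiv ℝ f) x

/-- The third derivative `D³f(x)[u, u, v]`: the derivative at `x` in direction `v` of
the Hessian, evaluated at `(u, u)`. -/
def thirdDeriv (f : E → ℝ) (x u v : E) : ℝ :=
  fderiv ℝ (hess f) x v u u

/-- `f` is convex and three times continuously differentiable on `Q`, and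
Quasi-Self-Concordant there with parameter `M`. -/
structure IsQuasiSelfConcordantOn (Q : Set E) (f : E → ℝ) (M : ℝ) : Prop where
  convexOn : ConvexOn ℝ Q f
  contDiffAt : ∀ x ∈ Q, ContDiffAt ℝ 3 f x
  thirdDeriv_le : ∀ x ∈ Q, ∀ u v : E, thirdDeriv f x u v ≤ M * hess f x u u * ‖v‖

/-- The extended-valued function with effective domain `Q` and values `ψ` on `Q` is
proper, convex and closed (its epigraph is closed). -/
structure IsClosedConvexProper (Q : Set E) (ψ : E → ℝ) : Prop where
  nonempty : Q.Nonempty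
  convexOn : ConvexOn ℝ Q ψ
  isClosed_epigraph : IsClosed {w : E × ℝ | w.1 ∈ Q ∧ ψ w.1 ≤ w.2}

/-- The subdifferential at `x` of the function with effective domain `Q` and values `F` on `Q`. -/
def subdiff (Q : Set E) (F : E → ℝ) (x : E) : Set (E →L[ℝ] ℝ) :=
  {p | x ∈ Q ∧ ∀ y ∈ Q, F x + p (y - x) ≤ F y}

/-! ### Dual Newton Method -/

/-- The objective of the auxiliary subproblem at `z` with prox-center `x`:
`⟨∇f(z), y - z⟩ + 1/2 ‖y - z‖_z² + σ ‖y - x‖² + ψ(y)`. -/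
def newtonModel (f ψ : E → ℝ) (x z : E) (σ : ℝ) (y : E) : ℝ :=
  fderiv ℝ f z (y - z) + 1 / 2 * hess f z (y - z) (y - z) + σ * ‖y - x‖ ^ 2 + ψ y

/-- `z' ∈ argmin_{y ∈ Q} newtonModel f ψ x z σ y`. -/
def IsNewtonStep (Q : Set E) (f ψ : E → ℝ) (x z : E) (σ : ℝ) (z' : E) : Prop :=
  z' ∈ Q ∧ ∀ y ∈ Q, newtonModel f ψ x z σ z' ≤ newtonModel f ψ x z σ y

/-- `s = ∇f(z') - ∇f(z) - ∇²f(z)(z' - z)`. -/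
def taylorResidual (f : E → ℝ) (z z' : E) : E →L[ℝ] ℝ :=
  fderiv ℝ f z' - fderiv ℝ f z - hess f z (z' - z)

/-- Iteration number `k ≥ 0` of the Dual Newton Method leads from `(x_k, g_k) = (x, g)` to
`(x_{k+1}, g_{k+1}) = (x', g')`: starting from `z 0 = x`, the inner loop performs the Newton steps
`z 0, z 1, …, z (T + 1)` and stops at the first one which satisfies
`‖s_{t+1}‖_* ≤ 2 M g ν / (k + 1)²`. -/
def IsDualNewtonIteration (Q : Set E) (f ψ : E → ℝ) (M ν : ℝ) (k : ℕ) (x : E) (g : ℝ)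
    (x' : E) (g' : ℝ) : Prop :=
  ∃ (z : ℕ → E) (T : ℕ),
    z 0 = x ∧
    (∀ t ≤ T, IsNewtonStep Q f ψ x (z t) (M * g) (z (t + 1))) ∧
    (∀ t < T, 2 * M * g * ν / ((k : ℝ) + 1) ^ 2 < ‖taylorResidual f (z t) (z (t + 1))‖) ∧
    ‖taylorResidual f (z T) (z (T + 1))‖ ≤ 2 * M * g * ν / ((k : ℝ) + 1) ^ 2 ∧
    x' = z (T + 1) ∧
    g' = ‖taylorResidual f (z T) (z (T + 1)) - (2 * M * g) • innerSL ℝ (x' - x)‖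

/-- The Dual Newton Method `𝒟(f, ψ, x₀, M, ν)`, initialized with `g_0 = ‖p‖_*` for the
subgradient `p ∈ ∂(f + ψ)(x₀)`, stops after exactly `I` iterations and returns `xbar`. -/
def DualNewtonReturns (Q : Set E) (f ψ : E → ℝ) (x₀ : E) (M ν : ℝ) (p : E →L[ℝ] ℝ)
    (xbar : E) (I : ℕ) : Prop :=
  p ∈ subdiff Q (fun y => f y + ψ y) x₀ ∧
  ∃ (x : ℕ → E) (g : ℕ → ℝ),
    x 0 = x₀ ∧ g 0 = ‖p‖ ∧ 1 ≤ I ∧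
    (∀ k < I, IsDualNewtonIteration Q f ψ M ν k (x k) (g k) (x (k + 1)) (g (k + 1))) ∧
    (∀ k, k + 1 < I → ν < g (k + 1)) ∧
    g I ≤ ν ∧ x I = xbar

/-! ### Accelerated Newton Scheme -/

/-- `A_k = A_0 (1 - γ)^{-k}`, that is `A_{k+1} = A_k / (1 - γ)`. -/
def accA (A₀ γ : ℝ) (k : ℕ) : ℝ := A₀ / (1 - γ) ^ k

/-- The contracted smooth part `A_{k+1} f(γ x + (1 - γ) x_k)`. -/
def accSmooth (f : E → ℝ) (A₀ γ : ℝ) (k : ℕ) (xk : E) (x : E) : ℝ :=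
  accA A₀ γ (k + 1) * f (γ • x + (1 - γ) • xk)

/-- The augmented composite part `a_{k+1} ψ(x) + 1/2 ‖x - v_k‖²`, where
`a_{k+1} = γ / (1 - γ) * A_k`. -/
def accComposite (ψ : E → ℝ) (A₀ γ : ℝ) (k : ℕ) (vk : E) (x : E) : ℝ :=
  γ / (1 - γ) * accA A₀ γ k * ψ x + 1 / 2 * ‖x - vk‖ ^ 2

/-- At iteration `k` and in the state `(x_k, v_k) = (xk, vk)`, the inner call
`𝒟(f̄_k, ψ̄_k, v_k, γ M, ν_{k+1})`, `ν_{k+1} = R / (k + 1)²`, initialized with the subgradient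
`p ∈ ∂h_k(v_k)`, returns `v'` after exactly `I` iterations of the Dual Newton Method. -/
def InnerCallReturns (Q : Set E) (f ψ : E → ℝ) (M R A₀ γ : ℝ) (k : ℕ) (xk vk : E)
    (p : E →L[ℝ] ℝ) (v' : E) (I : ℕ) : Prop :=
  DualNewtonReturns Q (accSmooth f A₀ γ k xk) (accComposite ψ A₀ γ k vk) vk (γ * M)
    (R / ((k : ℝ) + 1) ^ 2) p v' I

/-- `x` and `v` are the sequences generated from `x₀` by iteration numbers `k = 0, 1, …` with
`k < n` of the Accelerated Newton Scheme (`n = ⊤`: all iterations), for some selection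
of the initial subgradients in the inner calls, and `I k` is the number of iterations of
the Dual Newton Method performed at iteration `k`. -/
def IsAcceleratedNewtonRun (Q : Set E) (f ψ : E → ℝ) (M R A₀ γ : ℝ) (x₀ : E) (n : ℕ∞)
    (x v : ℕ → E) (I : ℕ → ℕ) : Prop :=
  x 0 = x₀ ∧ v 0 = x₀ ∧
  ∀ k : ℕ, (k : ℕ∞) < n →
    (∃ p, InnerCallReturns Q f ψ M R A₀ γ k (x k) (v k) p (v (k + 1)) (I k)) ∧
    x (k + 1) = γ • v (k + 1) + (1 - γ) • x k

/-! ### Constants in the complexity bound -/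

/-- The norms `‖∇²f(x)‖`, `x ∈ Q`, `‖x - xs‖ ≤ r`. -/
def hessNorms (Q : Set E) (f : E → ℝ) (xs : E) (r : ℝ) : Set ℝ :=
  {t | ∃ x ∈ Q, ‖x - xs‖ ≤ r ∧ t = ‖hess f x‖}

/-- The norms `‖ψ'(x)‖_*`, `ψ'(x) ∈ ∂ψ(x)`, `x ∈ Q`, `‖x - xs‖ ≤ r`. -/
def subgradNorms (Q : Set E) (ψ : E → ℝ) (xs : E) (r : ℝ) : Set ℝ :=
  {t | ∃ x ∈ Q, ‖x - xs‖ ≤ r ∧ ∃ p ∈ subdiff Q ψ x, t = ‖p‖}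

/-- The residuals `F(x) - F(xs)`, `x ∈ Q`, `‖x - xs‖ ≤ r`. -/
def residuals (Q : Set E) (F : E → ℝ) (xs : E) (r : ℝ) : Set ℝ :=
  {t | ∃ x ∈ Q, ‖x - xs‖ ≤ r ∧ t = F x - F xs}

/-- `𝓛 = ln [ (MR)^{2/3} R / Δ * (√(L_f 𝓕₀) + L_ψ) * (1/ε) * ln² (1/ε) ]`. -/
def logFactor (M R Δ Lf Lψ F₀ ε : ℝ) : ℝ :=
  Real.log ((M * R) ^ ((2 : ℝ) / 3) * R / Δ * (Real.sqrt (Lf * F₀) + Lψ) *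
    (1 / ε) * Real.log (1 / ε) ^ 2)

end QSCNewton

end

/-!
The total number of iterations of the Dual Newton Method splits into three estimates.

*Accelerated scheme.* Each inner call returns a point `v_{k+1}` at which the `1`-strongly convex
objective `f̄_k + ψ̄_k` has a subgradient of norm at most `R / (k + 1)²`. Comparing this point with
the solution shows that the potential `2 A_k (F(x_k) - F⋆) + ‖v_k - x⋆‖²` decreases by
`‖v_{k+1} - v_k‖²`, up to a summable error (`InnerCallReturns.potential_le`). By the elementary
recursion `perturbed_descent`, the `v_k` stay in the ball of radius `(5 + c) R` about `x⋆`, the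
squares `‖v_{k+1} - v_k‖²` sum to at most `(5 + c)² R²`, and `F(x_k) - F⋆` decreases like
`(1 - γ)^k` (`IsAcceleratedNewtonRun.potential_le`, `exists_gap_le`).

*Inner loop.* One iteration of the Dual Newton Method is a proximal-point step with coefficient
`β = 2 N g`, where `N = γ M` is the Quasi-Self-Concordance parameter of `f̄_k`. As `g` is the norm of
a subgradient at the prox-center, all relevant displacements have length at most `1 / (2 N)`, where
the Hessian changes by at most a constant factor. Hence Newton's method converges quadratically on
the regularized subproblem (`IsNewtonStep.norm_taylorResidual_le`), and the inner loop terminates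
(`exists_isDualNewtonIteration`).

*Dual Newton Method.* The ratio `g_{j+1} / g_j` is at most `2 N` times the length of step `j`, up to
the inexactness. For a proximal-point method the squared step lengths are summable, with a sum of
the order of the squared distance `D²` to the minimizer, whereas the product of the ratios is at
least `ν / g_0` until the method stops. The inequality `log q ≤ q - 1` for the squared ratios then
bounds the number of iterations by `O(N² (D² + ν²) + log (g_0 / ν))` (`iterations_le`). Here `D` is
comparable to `‖v_{k+1} - v_k‖`, so the first terms sum over all calls to
`O(γ² M² R²) = O((M R)^{2/3})`. The logarithms are of the order of `𝓛` because `g_0 / ν` is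
polynomial in the quantities under the logarithm (`IsAcceleratedNewtonRun.log_subgradient_le`).
-/

namespace QSCNewton

variable {E : Type u} [NormedAddCommGroup E] [InnerProductSpace ℝ E]

/-! ### Subgradients and minimizers of strongly convex functions -/

/-- A differentiable summand can be split off from a subgradient, whether or not it is convex. With
`p = 0` this is the first-order optimality condition of composite minimization. -/
theorem sub_mem_subdiff {Q : Set E} {q φ : E → ℝ} {x : E} {p q' : E →L[ℝ] ℝ}
    (hφ : ConvexOn ℝ Q φ) (hq : HasFDerivAt q q' x)
    (hp : p ∈ subdiff Q (fun y => q y + φ y) x) : p - q' ∈ subdiff Q φ x := by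
  obtain ⟨hx, hp⟩ := hp
  refine ⟨hx, fun y hy => ?_⟩
  have hlim := (hq.hasLineDerivAt (y - x)).tendsto_slope_zero_right
  have key : p (y - x) + φ x - φ y ≤ q' (y - x) := by
    refine ge_of_tendsto hlim ?_
    filter_upwards [Ioo_mem_nhdsGT (show (0 : ℝ) < 1 by norm_num)] with t ht
    have hmem : x + t • (y - x) ∈ Q := hφ.1.add_smul_sub_mem hx hy ⟨ht.1.le, ht.2.le⟩
    have h1 := hp _ hmem
    have h2 := hφ.2 hx hy (by linarith [ht.2] : (0 : ℝ) ≤ 1 - t) ht.1.le (by ring)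
    rw [show (1 - t) • x + t • y = x + t • (y - x) by module] at h2
    simp only [add_sub_cancel_left, map_smul, smul_eq_mul] at h1 h2 ⊢
    rw [le_inv_mul_iff₀ ht.1]
    linarith
  simp only [sub_apply]
  linarith

theorem fderiv_mem_subdiff {Q : Set E} {f : E → ℝ} {x : E} (hf : ConvexOn ℝ Q f) (hx : x ∈ Q)
    (hd : DifferentiableAt ℝ f x) : fderiv ℝ f x ∈ subdiff Q f x := by
  have := sub_mem_subdiff (p := 0) hf hd.hasFDerivAt.neg ⟨hx, fun y _ => by simp⟩
  simpa using this

theorem add_mem_subdiff {Q : Set E} {F G : E → ℝ} {x : E} {p q : E →L[ℝ] ℝ}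
    (hp : p ∈ subdiff Q F x) (hq : q ∈ subdiff Q G x) :
    p + q ∈ subdiff Q (fun y => F y + G y) x := by
  refine ⟨hp.1, fun y hy => ?_⟩
  have h1 := hp.2 y hy
  have h2 := hq.2 y hy
  simp only [add_apply]
  linarith

/-- Subgradient inequality of a strongly convex function. -/
theorem subdiff_strong {Q : Set E} {F : E → ℝ} {m : ℝ} {x y : E} {p : E →L[ℝ] ℝ}
    (hF : StrongConvexOn Q m F) (hp : p ∈ subdiff Q F x) (hy : y ∈ Q) :
    F x + p (y - x) + m / 2 * ‖y - x‖ ^ 2 ≤ F y := by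
  obtain ⟨hx, hp⟩ := hp
  have hlim : Filter.Tendsto (fun t : ℝ => p (y - x) + (1 - t) * (m / 2 * ‖y - x‖ ^ 2))
      (nhdsWithin 0 (Ioi 0)) (nhds (p (y - x) + (1 - 0) * (m / 2 * ‖y - x‖ ^ 2))) :=
    Filter.Tendsto.mono_left (Continuous.tendsto (by fun_prop) 0) nhdsWithin_le_nhds
  have key : p (y - x) + (1 - 0) * (m / 2 * ‖y - x‖ ^ 2) ≤ F y - F x := by
    refine le_of_tendsto hlim ?_
    filter_upwards [Ioo_mem_nhdsGT (show (0 : ℝ) < 1 by norm_num)] with t ht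
    have hmem : x + t • (y - x) ∈ Q := hF.1.add_smul_sub_mem hx hy ⟨ht.1.le, ht.2.le⟩
    have h1 := hp _ hmem
    have h2 := hF.2 hx hy (by linarith [ht.2] : (0 : ℝ) ≤ 1 - t) ht.1.le (by ring)
    rw [show (1 - t) • x + t • y = x + t • (y - x) by module, norm_sub_rev x y] at h2
    simp only [add_sub_cancel_left, map_smul, smul_eq_mul] at h1 h2
    have h3 : t * (p (y - x) + (1 - t) * (m / 2 * ‖y - x‖ ^ 2)) ≤ t * (F y - F x) := by linarith
    exact le_of_mul_le_mul_left h3 ht.1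
  linarith

/-- The subdifferential of a strongly convex function is strongly monotone. -/
theorem subdiff_monotone {Q : Set E} {F : E → ℝ} {m : ℝ} {x y : E} {p q : E →L[ℝ] ℝ}
    (hF : StrongConvexOn Q m F) (hp : p ∈ subdiff Q F x) (hq : q ∈ subdiff Q F y) :
    m * ‖y - x‖ ^ 2 ≤ (q - p) (y - x) := by
  have h1 := subdiff_strong hF hp hq.1
  have h2 := subdiff_strong hF hq hp.1
  have h3 : q (x - y) = -q (y - x) := by rw [← map_neg, neg_sub]
  rw [norm_sub_rev x y, h3] at h2
  simp only [sub_apply]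
  linarith

/-- Minimizers exist for the sum of a closed strongly convex function and a continuous function
with an affine minorant. The minimum is attained on a compact part of the epigraph. -/
theorem exists_forall_add_le [FiniteDimensional ℝ E] {Q : Set E} {q φ : E → ℝ}
    (hφ : IsClosedConvexProper Q φ) (hsc : StrongConvexOn Q 1 φ) (hq : ContinuousOn q Q)
    {x : E} {p ℓ : E →L[ℝ] ℝ} {c : ℝ} (hp : p ∈ subdiff Q φ x) (hℓ : ∀ y ∈ Q, ℓ y + c ≤ q y) :
    ∃ y ∈ Q, ∀ w ∈ Q, q y + φ y ≤ q w + φ w := by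
  obtain ⟨m, hm⟩ : ∃ m, m = q x + φ x := ⟨_, rfl⟩
  obtain ⟨C, hC⟩ : ∃ C, C = |m - ℓ x - c - φ x| := ⟨_, rfl⟩
  obtain ⟨r, hr⟩ : ∃ r, r = 2 * ‖ℓ + p‖ + C + 2 := ⟨_, rfl⟩
  have hC0 : 0 ≤ C := hC ▸ abs_nonneg _
  have hr0 : 0 ≤ r := by rw [hr]; positivity
  -- the sublevel set of `x` is bounded, by strong convexity of `φ`
  have hball : ∀ y ∈ Q, q y + φ y ≤ m → ‖y - x‖ ≤ r := by
    intro y hy hym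
    by_contra! hlt
    have h1 := subdiff_strong hsc hp hy
    have h2 := hℓ y hy
    have h3 : ℓ y = ℓ x + ℓ (y - x) := by rw [← map_add, add_sub_cancel]
    have h4 : -(ℓ (y - x) + p (y - x)) ≤ ‖ℓ + p‖ * ‖y - x‖ := by
      have := (ℓ + p).le_opNorm (y - x)
      rw [Real.norm_eq_abs] at this
      exact (neg_le_abs _).trans this
    have h5 : m - ℓ x - c - φ x ≤ C := hC ▸ le_abs_self _
    have hn := norm_nonneg (ℓ + p)
    nlinarith
  obtain ⟨b, hb⟩ : ∃ b, b = m - c - ℓ x + ‖ℓ‖ * r := ⟨_, rfl⟩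
  have hmem : ∀ y ∈ Q, q y + φ y ≤ m →
      (y, φ y) ∈ {w : E × ℝ | w.1 ∈ Q ∧ φ w.1 ≤ w.2} ∩
        (Metric.closedBall x r ×ˢ Icc (φ x - ‖p‖ * r) b) := by
    intro y hy hym
    have hyr := hball y hy hym
    have h1 := hp.2 y hy
    have h2 := hℓ y hy
    have h3 : ℓ y = ℓ x + ℓ (y - x) := by rw [← map_add, add_sub_cancel]
    have h4 : |ℓ (y - x)| ≤ ‖ℓ‖ * r := ℓ.le_of_opNorm_le_of_le le_rfl hyr
    have h5 : |p (y - x)| ≤ ‖p‖ * r := p.le_of_opNorm_le_of_le le_rfl hyr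
    refine ⟨⟨hy, le_rfl⟩, ?_, ?_, ?_⟩
    · simpa [dist_eq_norm] using hyr
    · simp only; linarith [neg_le_of_abs_le h5]
    · simp only; linarith [neg_le_of_abs_le h4]
  have hcomp : IsCompact ({w : E × ℝ | w.1 ∈ Q ∧ φ w.1 ≤ w.2} ∩
      (Metric.closedBall x r ×ˢ Icc (φ x - ‖p‖ * r) b)) :=
    ((isCompact_closedBall x r).prod isCompact_Icc).inter_left hφ.isClosed_epigraph
  have hcont : ContinuousOn (fun w : E × ℝ => q w.1 + w.2)
      ({w : E × ℝ | w.1 ∈ Q ∧ φ w.1 ≤ w.2} ∩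
        (Metric.closedBall x r ×ˢ Icc (φ x - ‖p‖ * r) b)) :=
    (hq.comp continuousOn_fst fun w hw => hw.1.1).add continuousOn_snd
  obtain ⟨⟨y, t⟩, hy, hmin⟩ := hcomp.exists_isMinOn ⟨_, hmem x hp.1 hm.ge⟩ hcont
  have hle : ∀ w ∈ Q, q w + φ w ≤ m → q y + φ y ≤ q w + φ w := fun w hw hwm =>
    (add_le_add le_rfl hy.1.2).trans (isMinOn_iff.1 hmin _ (hmem w hw hwm))
  refine ⟨y, hy.1.1, fun w hw => ?_⟩
  rcases le_total (q w + φ w) m with h | h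
  · exact hle w hw h
  · exact ((hle x hp.1 hm.ge).trans hm.ge).trans h

/-! ### Quasi-Self-Concordant functions along segments -/

theorem monotone_endpoints {φ φ' : ℝ → ℝ} {b : ℝ} (hb : 0 ≤ b)
    (h : ∀ t ∈ Icc 0 b, HasDerivAt φ (φ' t) t) (h' : ∀ t ∈ Icc 0 b, 0 ≤ φ' t) : φ 0 ≤ φ b := by
  refine monotoneOn_of_deriv_nonneg (convex_Icc 0 b)
    (fun t ht => (h t ht).continuousAt.continuousWithinAt) (fun t ht => ?_) (fun t ht => ?_)
    (left_mem_Icc.2 hb) (right_mem_Icc.2 hb) hb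
  · exact (h t (interior_subset ht)).differentiableAt.differentiableWithinAt
  · rw [(h t (interior_subset ht)).deriv]
    exact h' t (interior_subset ht)

/-- Evaluation of bilinear forms at `(u, v)`, as a continuous linear functional. -/
noncomputable def evalPair (u v : E) : (E →L[ℝ] E →L[ℝ] ℝ) →L[ℝ] ℝ :=
  (ContinuousLinearMap.apply ℝ ℝ v).comp (ContinuousLinearMap.apply ℝ (E →L[ℝ] ℝ) u)

@[simp] theorem evalPair_apply (u v : E) (H : E →L[ℝ] E →L[ℝ] ℝ) : evalPair u v H = H u v := rfl

namespace IsQuasiSelfConcordantOn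

variable {Q : Set E} {f : E → ℝ} {M : ℝ} {x y z d u v h : E}

theorem differentiableAt (hf : IsQuasiSelfConcordantOn Q f M) (hx : x ∈ Q) :
    DifferentiableAt ℝ f x :=
  (hf.contDiffAt x hx).differentiableAt (by norm_num)

theorem hasFDerivAt_fderiv (hf : IsQuasiSelfConcordantOn Q f M) (hx : x ∈ Q) :
    HasFDerivAt (fderiv ℝ f) (hess f x) x :=
  (((hf.contDiffAt x hx).fderiv_right (m := 2) (by norm_num)).differentiableAt
    (by norm_num)).hasFDerivAt

theorem hasFDerivAt_hess (hf : IsQuasiSelfConcordantOn Q f M) (hx : x ∈ Q) :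
    HasFDerivAt (hess f) (fderiv ℝ (hess f) x) x :=
  ((((hf.contDiffAt x hx).fderiv_right (m := 2) (by norm_num)).fderiv_right (m := 1)
    (by norm_num)).differentiableAt (by norm_num)).hasFDerivAt

theorem hasFDerivAt_hess_apply (hf : IsQuasiSelfConcordantOn Q f M) (hx : x ∈ Q) (u v : E) :
    HasFDerivAt (fun y => hess f y u v) ((evalPair u v).comp (fderiv ℝ (hess f) x)) x :=
  (((hf.hasFDerivAt_hess hx).clm_apply (hasFDerivAt_const u x)).clm_apply
    (hasFDerivAt_const v x)).congr_fderiv (by ext; simp)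

theorem hess_comm (hf : IsQuasiSelfConcordantOn Q f M) (hx : x ∈ Q) (u v : E) :
    hess f x u v = hess f x v u :=
  (hf.contDiffAt x hx).isSymmSndFDerivAt (by simp; norm_num) u v

/-- Since `D³f(x)[u, u, v]` is odd in `v`, Quasi-Self-Concordance bounds it from both sides. -/
theorem abs_thirdDeriv_le (hf : IsQuasiSelfConcordantOn Q f M) (hx : x ∈ Q) (u v : E) :
    |thirdDeriv f x u v| ≤ M * hess f x u u * ‖v‖ := by
  have h1 := hf.thirdDeriv_le x hx u v
  have h2 := hf.thirdDeriv_le x hx u (-v)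
  simp only [thirdDeriv, map_neg, neg_apply, norm_neg] at h1 h2
  exact abs_le.2 ⟨by linarith! [h2], h1⟩

/-- Convexity on `Q` only gives this for directions along `Q`; Quasi-Self-Concordance, assumed in all
directions, gives it on the whole space. -/
theorem hess_nonneg (hf : IsQuasiSelfConcordantOn Q f M) (hM : 0 < M) (hx : x ∈ Q) (u : E) :
    0 ≤ hess f x u u := by
  rcases eq_or_ne u 0 with rfl | hu
  · simp
  · have h := (abs_nonneg _).trans (hf.abs_thirdDeriv_le hx u u)
    by_contra! hlt
    have : M * hess f x u u * ‖u‖ < 0 :=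
      mul_neg_of_neg_of_pos (mul_neg_of_pos_of_neg hM hlt) (norm_pos_iff.2 hu)
    linarith

/-- Symmetry of the third derivative, which turns the form `D³f(x)[u, u, v]` of the definition into
the one that occurs in Taylor expansions along `u`. -/
theorem fderiv_hess_symm (hf : IsQuasiSelfConcordantOn Q f M) (hx : x ∈ Q) (u v : E) :
    fderiv ℝ (hess f) x u u v = thirdDeriv f x u v := by
  -- symmetry of the Hessian holds near `x`, and can therefore be differentiated
  have h1 : (fun y => hess f y u v) =ᶠ[nhds x] fun y => hess f y v u := by
    have : ∀ᶠ y in nhds x, ContDiffAt ℝ 3 f y :=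
      (hf.contDiffAt x hx).eventually (by simp)
    filter_upwards [this] with y hy
    exact hy.isSymmSndFDerivAt (by simp; norm_num) u v
  have h2 := congrArg (fun L : E →L[ℝ] ℝ => L u) ((hf.hasFDerivAt_hess_apply hx u v).unique
    ((hf.hasFDerivAt_hess_apply hx v u).congr_of_eventuallyEq h1))
  have h3 : fderiv ℝ (hess f) x u v = fderiv ℝ (hess f) x v u :=
    ((hf.contDiffAt x hx).fderiv_right (m := 2) (by norm_num)).isSymmSndFDerivAt (by simp) u v
  simp only [ContinuousLinearMap.comp_apply, evalPair_apply] at h2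
  rw [h2, h3, thirdDeriv]

theorem segment_mem (hf : IsQuasiSelfConcordantOn Q f M) (hz : z ∈ Q) (hd : z + d ∈ Q) {t : ℝ}
    (ht : t ∈ Icc (0 : ℝ) 1) : z + t • d ∈ Q := by
  have := hf.convexOn.1.add_smul_sub_mem hz hd ht
  rwa [add_sub_cancel_left] at this

theorem hasDerivAt_segment (z d : E) (t : ℝ) : HasDerivAt (fun t : ℝ => z + t • d) d t := by
  simpa using ((hasDerivAt_id t).smul_const d).const_add z

theorem hasDerivAt_fderiv_segment (hf : IsQuasiSelfConcordantOn Q f M) {t : ℝ}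
    (ht : z + t • d ∈ Q) (h : E) :
    HasDerivAt (fun t : ℝ => fderiv ℝ f (z + t • d) h) (hess f (z + t • d) d h) t :=
  (ContinuousLinearMap.apply ℝ ℝ h).hasFDerivAt.comp_hasDerivAt t
    ((hf.hasFDerivAt_fderiv ht).comp_hasDerivAt t (hasDerivAt_segment z d t))

theorem hasDerivAt_hess_segment (hf : IsQuasiSelfConcordantOn Q f M) {t : ℝ}
    (ht : z + t • d ∈ Q) (u v : E) :
    HasDerivAt (fun t : ℝ => hess f (z + t • d) u v)
      (fderiv ℝ (hess f) (z + t • d) d u v) t :=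
  HasFDerivAt.comp_hasDerivAt (f := fun t : ℝ => z + t • d) t (hf.hasFDerivAt_hess_apply ht u v)
    (hasDerivAt_segment z d t)

/-- Along a segment, the Hessian grows at most exponentially. -/
theorem hess_segment_le (hf : IsQuasiSelfConcordantOn Q f M) (hz : z ∈ Q)
    (hd : z + d ∈ Q) {t : ℝ} (ht : t ∈ Icc (0 : ℝ) 1) (u : E) :
    hess f (z + t • d) u u ≤ Real.exp (M * ‖d‖ * t) * hess f z u u := by
  have key := monotone_endpoints (b := t) ht.1
    (φ := fun τ => -(Real.exp (-(M * ‖d‖) * τ) * hess f (z + τ • d) u u))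
    (fun τ hτ => (((((hasDerivAt_id τ).const_mul (-(M * ‖d‖))).exp).mul
      (hf.hasDerivAt_hess_segment (hf.segment_mem hz hd ⟨hτ.1, hτ.2.trans ht.2⟩) u u)).neg))
    (fun τ hτ => ?_)
  · simp only [mul_zero, Real.exp_zero, zero_smul, add_zero, one_mul, neg_le_neg_iff] at key
    calc hess f (z + t • d) u u
        = Real.exp (M * ‖d‖ * t) * (Real.exp (-(M * ‖d‖) * t) * hess f (z + t • d) u u) := by
          rw [← mul_assoc, ← Real.exp_add]; simp
      _ ≤ _ := by gcongr
  · have h1 := hf.thirdDeriv_le _ (hf.segment_mem hz hd ⟨hτ.1, hτ.2.trans ht.2⟩) u d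
    rw [thirdDeriv] at h1
    have := mul_le_mul_of_nonneg_left h1 (Real.exp_pos (-(M * ‖d‖) * τ)).le
    simp only [id_eq, mul_one]
    linarith

/-- The residual of the linearization of the gradient is controlled by the squared local norm
of a short displacement. -/
theorem norm_taylorResidual_le (hf : IsQuasiSelfConcordantOn Q f M) (hM : 0 < M) (hz : z ∈ Q)
    (hy : y ∈ Q) (hd : M * ‖y - z‖ ≤ 1 / 2) :
    ‖taylorResidual f z y‖ ≤ M * hess f z (y - z) (y - z) := by
  obtain ⟨d, rfl⟩ : ∃ d, y = z + d := ⟨y - z, by simp⟩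
  rw [add_sub_cancel_left] at hd ⊢
  have hw0 := hf.hess_nonneg hM hz d
  have hexp : Real.exp (1 / 2) ≤ 2 := by
    have h1 := Real.add_one_le_exp (-(1 / 2) : ℝ)
    rw [Real.exp_neg] at h1
    have h2 := Real.exp_pos (1 / 2)
    rw [show (-(1 / 2) + 1 : ℝ) = 1 / 2 by norm_num, le_inv_comm₀ (by norm_num) h2] at h1
    linarith
  have hw : ∀ t ∈ Icc (0 : ℝ) 1, hess f (z + t • d) d d ≤ 2 * hess f z d d := by
    intro t ht
    refine (hf.hess_segment_le hz hy ht d).trans ?_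
    gcongr
    refine (Real.exp_le_exp.2 ?_).trans hexp
    have := mul_nonneg hM.le (norm_nonneg d)
    nlinarith [ht.1, ht.2]
  -- it suffices to bound the residual from above, in each direction
  have key : ∀ h : E, taylorResidual f z (z + d) h ≤ M * hess f z d d * ‖h‖ := by
    intro h
    obtain ⟨K, hK⟩ : ∃ K, K = M * hess f z d d * ‖h‖ := ⟨_, rfl⟩
    -- two integrations of `D³f(z + t d)[d, d, h] ≤ 2 K`
    have hmid : ∀ t ∈ Icc (0 : ℝ) 1,
        0 ≤ 2 * K * t - (hess f (z + t • d) d h - hess f z d h) := by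
      intro t ht
      have := monotone_endpoints (b := t) ht.1
        (φ := fun τ => 2 * K * τ - (hess f (z + τ • d) d h - hess f z d h))
        (fun τ hτ => ((hasDerivAt_id τ).const_mul (2 * K)).sub
          ((hf.hasDerivAt_hess_segment
            (hf.segment_mem hz hy ⟨hτ.1, hτ.2.trans ht.2⟩) d h).sub_const _))
        (fun τ hτ => ?_)
      · simpa using this
      · have hmem := hf.segment_mem hz hy ⟨hτ.1, hτ.2.trans ht.2⟩
        rw [hf.fderiv_hess_symm hmem, sub_nonneg, mul_one]
        refine (hf.thirdDeriv_le _ hmem d h).trans ?_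
        have := mul_le_mul_of_nonneg_right (mul_le_mul_of_nonneg_left
          (hw τ ⟨hτ.1, hτ.2.trans ht.2⟩) hM.le) (norm_nonneg h)
        rw [hK]
        linarith
    have := monotone_endpoints (b := 1) zero_le_one
      (φ := fun τ => K * τ ^ 2 - (fderiv ℝ f (z + τ • d) h - fderiv ℝ f z h - τ * hess f z d h))
      (fun τ hτ => ((hasDerivAt_pow 2 τ).const_mul K).sub
        (((hf.hasDerivAt_fderiv_segment (hf.segment_mem hz hy hτ) h).sub_const _).sub
          ((hasDerivAt_id τ).mul_const (hess f z d h))))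
      (fun τ hτ => by
        have := hmid τ hτ
        simp only [Nat.cast_ofNat, Nat.add_one_sub_one, pow_one, one_mul]
        linarith)
    simp only [ne_eq, OfNat.ofNat_ne_zero, not_false_eq_true, zero_pow, mul_zero, zero_smul,
      add_zero, sub_self, zero_mul, one_pow, mul_one, one_smul, one_mul] at this
    simp only [taylorResidual, add_sub_cancel_left, sub_apply]
    linarith
  refine ContinuousLinearMap.opNorm_le_bound _ (mul_nonneg hM.le hw0) fun h => ?_
  rw [Real.norm_eq_abs, abs_le]
  have h1 := key h
  have h2 := key (-h)
  rw [map_neg, norm_neg] at h2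
  exact ⟨by linarith, h1⟩

theorem norm_fderiv_sub_le (hf : IsQuasiSelfConcordantOn Q f M) (hz : z ∈ Q) (hy : y ∈ Q) {L : ℝ}
    (hL : ∀ x ∈ segment ℝ z y, ‖hess f x‖ ≤ L) :
    ‖fderiv ℝ f y - fderiv ℝ f z‖ ≤ L * ‖y - z‖ :=
  (convex_segment z y).norm_image_sub_le_of_norm_hasFDerivWithin_le
    (fun _ hx => (hf.hasFDerivAt_fderiv
      (hf.convexOn.1.segment_subset hz hy hx)).hasFDerivWithinAt)
    hL (left_mem_segment ℝ z y) (right_mem_segment ℝ z y)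

end IsQuasiSelfConcordantOn

/-! ### The inner loop: Newton steps for the regularized subproblem -/

section NewtonStep

variable {Q : Set E} {f φ : E → ℝ} {N ν : ℝ} {x z z' : E} {σ : ℝ}

/-- First-order optimality condition of a Newton step. -/
theorem IsNewtonStep.mem_subdiff (hf : IsQuasiSelfConcordantOn Q f N) (hφ : ConvexOn ℝ Q φ)
    (hz : z ∈ Q) (h : IsNewtonStep Q f φ x z σ z') :
    -(fderiv ℝ f z + hess f z (z' - z) + (2 * σ) • innerSL ℝ (z' - x)) ∈ subdiff Q φ z' := by
  have hq : HasFDerivAt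
      (fun y => fderiv ℝ f z (y - z) + 1 / 2 * hess f z (y - z) (y - z) + σ * ‖y - x‖ ^ 2)
      (fderiv ℝ f z + hess f z (z' - z) + (2 * σ) • innerSL ℝ (z' - x)) z' := by
    have hsub : ∀ w : E, HasFDerivAt (fun y => y - w) (ContinuousLinearMap.id ℝ E) z' :=
      fun w => (hasFDerivAt_id z').sub_const w
    have h1 : HasFDerivAt (fun y => fderiv ℝ f z (y - z)) (fderiv ℝ f z) z' := by
      exact ((fderiv ℝ f z).hasFDerivAt (x := z' - z)).comp z' (hsub z)
    have h2 : HasFDerivAt (fun y => hess f z (y - z)) (hess f z) z' := by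
      exact ((hess f z).hasFDerivAt (x := z' - z)).comp z' (hsub z)
    have h3 := (h2.clm_apply (hsub z)).const_mul (1 / 2)
    have h4 := ((hsub x).norm_sq).const_mul σ
    refine ((h1.add h3).add h4).congr_fderiv ?_
    ext w
    have := hf.hess_comm hz w (z' - z)
    simp at this ⊢
    rw [this]
    ring
  have := sub_mem_subdiff (p := 0) hφ hq ⟨h.1, fun y hy => by simpa [newtonModel] using h.2 y hy⟩
  simpa using this

theorem exists_isNewtonStep [FiniteDimensional ℝ E] (hf : IsQuasiSelfConcordantOn Q f N)
    (hN : 0 < N) (hφ : IsClosedConvexProper Q φ) (hsc : StrongConvexOn Q 1 φ) {w : E}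
    {p : E →L[ℝ] ℝ} (hp : p ∈ subdiff Q φ w) (hz : z ∈ Q) (hσ : 0 ≤ σ) (x : E) :
    ∃ z', IsNewtonStep Q f φ x z σ z' := by
  obtain ⟨y, hy, hmin⟩ := exists_forall_add_le hφ hsc
    (q := fun y => fderiv ℝ f z (y - z) + 1 / 2 * hess f z (y - z) (y - z) + σ * ‖y - x‖ ^ 2)
    (Continuous.continuousOn (by fun_prop)) (ℓ := fderiv ℝ f z) (c := -fderiv ℝ f z z) hp
    (fun y _ => by
      have h1 := hf.hess_nonneg hN hz (y - z)
      have h2 := mul_nonneg hσ (sq_nonneg ‖y - x‖)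
      have h3 := map_sub (fderiv ℝ f z) y z
      linarith)
  exact ⟨y, hy, hmin⟩

theorem IsNewtonStep.eq (hf : IsQuasiSelfConcordantOn Q f N) (hN : 0 < N)
    (hsc : StrongConvexOn Q 1 φ) (hφ : ConvexOn ℝ Q φ) (hz : z ∈ Q) (hσ : 0 ≤ σ) {z'' : E}
    (h : IsNewtonStep Q f φ x z σ z') (h' : IsNewtonStep Q f φ x z σ z'') : z' = z'' := by
  have hm := subdiff_monotone hsc (h.mem_subdiff hf hφ hz) (h'.mem_subdiff hf hφ hz)
  obtain ⟨d, rfl⟩ : ∃ d, z'' = z' + d := ⟨z'' - z', by simp⟩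
  have h1 := hf.hess_nonneg hN hz d
  have h2 : (-(fderiv ℝ f z + hess f z (z' + d - z) + (2 * σ) • innerSL ℝ (z' + d - x)) -
      -(fderiv ℝ f z + hess f z (z' - z) + (2 * σ) • innerSL ℝ (z' - x))) (z' + d - z') =
      -(hess f z d d) - 2 * σ * ‖d‖ ^ 2 := by
    rw [add_sub_cancel_left, add_sub_right_comm, add_sub_right_comm, map_add, map_add,
      ← real_inner_self_eq_norm_sq]
    simp only [sub_apply, neg_apply, add_apply, smul_apply, innerSL_apply_apply, smul_eq_mul]
    ring
  rw [h2, add_sub_cancel_left] at hm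
  have h3 := mul_nonneg hσ (sq_nonneg ‖d‖)
  have h4 : ‖d‖ ^ 2 = 0 := le_antisymm (by linarith) (sq_nonneg _)
  simpa [eq_comm] using h4

/-- Bound on a Newton step from a point `z` at which the regularized objective
`f + σ ‖· - x‖² + φ` has the subgradient `p + ∇f(z) + 2 σ B (z - x)`. -/
theorem IsNewtonStep.bound (hf : IsQuasiSelfConcordantOn Q f N)
    (hsc : StrongConvexOn Q 1 φ) (hφ : ConvexOn ℝ Q φ) (hz : z ∈ Q)
    (h : IsNewtonStep Q f φ x z σ z') {p : E →L[ℝ] ℝ} (hp : p ∈ subdiff Q φ z) :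
    hess f z (z' - z) (z' - z) + (2 * σ + 1) * ‖z' - z‖ ^ 2 ≤
      ‖p + fderiv ℝ f z + (2 * σ) • innerSL ℝ (z - x)‖ * ‖z' - z‖ := by
  have hm := subdiff_monotone hsc hp (h.mem_subdiff hf hφ hz)
  have h1 := (neg_le_abs _).trans ((p + fderiv ℝ f z + (2 * σ) • innerSL ℝ (z - x)).le_opNorm
    (z' - z))
  refine le_trans ?_ h1
  obtain ⟨d, rfl⟩ : ∃ d, z' = z + d := ⟨z' - z, by simp⟩
  have h2 : (-(fderiv ℝ f z + hess f z (z + d - z) + (2 * σ) • innerSL ℝ (z + d - x)) - p)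
      (z + d - z) = -((p + fderiv ℝ f z + (2 * σ) • innerSL ℝ (z - x)) d)
        - hess f z d d - 2 * σ * ‖d‖ ^ 2 := by
    rw [add_sub_cancel_left, add_sub_right_comm, map_add, ← real_inner_self_eq_norm_sq]
    simp only [sub_apply, neg_apply, add_apply, smul_apply, innerSL_apply_apply, smul_eq_mul]
    ring
  rw [h2] at hm
  rw [add_sub_cancel_left] at hm ⊢
  linarith

/-- Newton's method on the subproblem with `2 σ = β` converges quadratically. -/
theorem IsNewtonStep.norm_taylorResidual_le (hf : IsQuasiSelfConcordantOn Q f N) (hN : 0 < N)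
    (hsc : StrongConvexOn Q 1 φ) (hφ : ConvexOn ℝ Q φ) (hz : z ∈ Q) (hσ : 0 < σ)
    (h : IsNewtonStep Q f φ x z σ z') {p : E →L[ℝ] ℝ} (hp : p ∈ subdiff Q φ z)
    (hs : N * ‖p + fderiv ℝ f z + (2 * σ) • innerSL ℝ (z - x)‖ ≤ σ) :
    ‖taylorResidual f z z'‖ ≤
      N * ‖p + fderiv ℝ f z + (2 * σ) • innerSL ℝ (z - x)‖ ^ 2 / (8 * σ) := by
  have hb := h.bound hf hsc hφ hz hp
  obtain ⟨s, hs'⟩ : ∃ s, s = ‖p + fderiv ℝ f z + (2 * σ) • innerSL ℝ (z - x)‖ := ⟨_, rfl⟩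
  rw [← hs'] at hb hs ⊢
  have h0 := hf.hess_nonneg hN hz (z' - z)
  have hn := norm_nonneg (z' - z)
  have hd : N * ‖z' - z‖ ≤ 1 / 2 := by
    by_contra! hlt
    have hpos : 0 < ‖z' - z‖ := by
      by_contra! h'
      rw [le_antisymm h' hn] at hlt
      norm_num at hlt
    have h1 : 2 * σ * ‖z' - z‖ ≤ s := by
      refine le_of_mul_le_mul_right ?_ hpos
      nlinarith
    nlinarith
  refine (hf.norm_taylorResidual_le hN hz h.1 hd).trans ?_
  rw [mul_div_assoc]
  refine mul_le_mul_of_nonneg_left ?_ hN.le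
  rw [le_div_iff₀ (by positivity)]
  nlinarith [sq_nonneg (s - 4 * σ * ‖z' - z‖), sq_nonneg ‖z' - z‖]

end NewtonStep

/-! ### One iteration of the Dual Newton Method -/

section Iteration

variable {Q : Set E} {f φ : E → ℝ} {N ν : ℝ} {k : ℕ} {x : E} {g : ℝ}

/-- An iteration of the Dual Newton Method is an inexact proximal-point step. -/
theorem IsDualNewtonIteration.exists_subgradient (hf : IsQuasiSelfConcordantOn Q f N)
    (hφ : ConvexOn ℝ Q φ) (hx : x ∈ Q) {x' : E} {g' : ℝ}
    (h : IsDualNewtonIteration Q f φ N ν k x g x' g') :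
    ∃ s : E →L[ℝ] ℝ, ‖s‖ ≤ 2 * N * g * ν / ((k : ℝ) + 1) ^ 2 ∧
      s - (2 * N * g) • innerSL ℝ (x' - x) ∈ subdiff Q (fun y => f y + φ y) x' ∧
      g' = ‖s - (2 * N * g) • innerSL ℝ (x' - x)‖ := by
  obtain ⟨z, T, hz0, hstep, -, hT, rfl, rfl⟩ := h
  refine ⟨_, hT, ?_, rfl⟩
  have hzT : z T ∈ Q := by
    cases T with
    | zero => exact hz0 ▸ hx
    | succ t => exact (hstep t (by omega)).1
  have h1 := (hstep T le_rfl).mem_subdiff hf hφ hzT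
  have h2 := fderiv_mem_subdiff hf.convexOn h1.1 (hf.differentiableAt h1.1)
  have h3 := add_mem_subdiff h2 h1
  convert h3 using 1
  simp only [taylorResidual, ← mul_assoc]
  abel

theorem IsDualNewtonIteration.unique (hf : IsQuasiSelfConcordantOn Q f N) (hN : 0 < N)
    (hφ : ConvexOn ℝ Q φ) (hsc : StrongConvexOn Q 1 φ) (hx : x ∈ Q) (hg : 0 ≤ g)
    {x' x'' : E} {g' g'' : ℝ} (h : IsDualNewtonIteration Q f φ N ν k x g x' g')
    (h' : IsDualNewtonIteration Q f φ N ν k x g x'' g'') : x' = x'' ∧ g' = g'' := by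
  obtain ⟨z, T, hz0, hstep, hlt, hT, rfl, rfl⟩ := h
  obtain ⟨w, S, hw0, hstep', hlt', hS, rfl, rfl⟩ := h'
  have hzQ : ∀ t ≤ T, z t ∈ Q := by
    intro t ht
    cases t with
    | zero => exact hz0 ▸ hx
    | succ t => exact (hstep t (by omega)).1
  have heq : ∀ t, t ≤ T + 1 → t ≤ S + 1 → z t = w t := by
    intro t
    induction t with
    | zero => exact fun _ _ => hz0.trans hw0.symm
    | succ t ih =>
      intro h1 h2
      have h3 := hstep' t (by omega)
      rw [← ih (by omega) (by omega)] at h3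
      exact (hstep t (by omega)).eq hf hN hsc hφ (hzQ t (by omega)) (mul_nonneg hN.le hg) h3
  have hTS : T = S := by
    rcases lt_trichotomy T S with hlt'' | heq' | hlt''
    · have := hlt' T hlt''
      rw [← heq T (by omega) (by omega), ← heq (T + 1) (by omega) (by omega)] at this
      exact absurd hT (not_le.2 this)
    · exact heq'
    · have := hlt S hlt''
      rw [heq S (by omega) (by omega), heq (S + 1) (by omega) (by omega)] at this
      exact absurd hS (not_le.2 this)
  subst hTS
  rw [heq T (by omega) (by omega), heq (T + 1) (by omega) (by omega)]
  exact ⟨rfl, rfl⟩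

/-- The inner loop terminates: its residuals decrease at least geometrically. -/
theorem exists_isDualNewtonIteration [FiniteDimensional ℝ E]
    (hf : IsQuasiSelfConcordantOn Q f N) (hN : 0 < N)
    (hφ : IsClosedConvexProper Q φ) (hsc : StrongConvexOn Q 1 φ) (hν : 0 < ν) {p : E →L[ℝ] ℝ}
    (hp : p ∈ subdiff Q (fun y => f y + φ y) x) (k : ℕ) :
    ∃ x' g', IsDualNewtonIteration Q f φ N ν k x ‖p‖ x' g' := by
  have hpφ := sub_mem_subdiff hφ.convexOn (hf.differentiableAt hp.1).hasFDerivAt hp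
  have hex : ∀ z : Q, ∃ z' : Q, IsNewtonStep Q f φ x z (N * ‖p‖) z' := fun z => by
    obtain ⟨z', hz'⟩ := exists_isNewtonStep hf hN hφ hsc hpφ z.2 (σ := N * ‖p‖)
      (by positivity) x
    exact ⟨⟨z', hz'.1⟩, hz'⟩
  choose step hstep using hex
  obtain ⟨z, hz⟩ : ∃ z : ℕ → Q, z = fun t => step^[t] ⟨x, hp.1⟩ := ⟨_, rfl⟩
  have hz0 : (z 0 : E) = x := by rw [hz]; rfl
  have hzs : ∀ t, IsNewtonStep Q f φ x (z t) (N * ‖p‖) (z (t + 1)) := fun t => by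
    simp only [hz, Function.iterate_succ_apply']
    exact hstep _
  suffices hT : ∃ T, ‖taylorResidual f (z T) (z (T + 1))‖ ≤
      2 * N * ‖p‖ * ν / ((k : ℝ) + 1) ^ 2 by
    classical
    exact ⟨_, _, fun t => z t, Nat.find hT, hz0, fun t _ => hzs t,
      fun t ht => not_le.1 (Nat.find_min hT ht), Nat.find_spec hT, rfl, rfl⟩
  rcases eq_or_ne p 0 with rfl | hp0
  · -- at a minimizer, the method does not move
    refine ⟨0, ?_⟩
    have hb := (hzs 0).bound hf hsc hφ.convexOn (z 0).2 (p := 0 - fderiv ℝ f x)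
      (by rw [hz0]; exact hpφ)
    have h0 := hf.hess_nonneg hN (z 0).2 (z 1 - z 0)
    simp only [hz0, zero_add, norm_zero, mul_zero, sub_self, map_zero, smul_zero, add_zero,
      zero_sub, neg_add_cancel, zero_mul, one_mul] at hb h0
    have h1 : ‖(z 1 : E) - x‖ ^ 2 = 0 := le_antisymm (by linarith) (sq_nonneg _)
    have h2 : (z 1 : E) = x := by simpa [sub_eq_zero] using h1
    simp [taylorResidual, hz0, h2]
  · have hpos : 0 < ‖p‖ := norm_pos_iff.2 hp0
    have hres : ∀ t : ℕ, ∀ q ∈ subdiff Q φ (z t),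
        ‖q + fderiv ℝ f (z t) + (2 * (N * ‖p‖)) • innerSL ℝ (z t - x)‖ ≤ ‖p‖ * (1 / 8) ^ t →
        ‖taylorResidual f (z t) (z (t + 1))‖ ≤ ‖p‖ * (1 / 8) ^ (t + 1) := by
      intro t q hq hle
      have hp1 : ((1 : ℝ) / 8) ^ t ≤ 1 := pow_le_one₀ (by norm_num) (by norm_num)
      have hle1 := hle.trans (mul_le_of_le_one_right hpos.le hp1)
      refine ((hzs t).norm_taylorResidual_le hf hN hsc hφ.convexOn (z t).2
        (by positivity) hq (by gcongr)).trans ?_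
      rw [div_le_iff₀ (by positivity), sq]
      calc _ ≤ N * (‖p‖ * (‖p‖ * (1 / 8) ^ t)) := by gcongr
        _ = _ := by ring
    have hdec : ∀ t : ℕ, ∃ q ∈ subdiff Q φ (z t),
        ‖q + fderiv ℝ f (z t) + (2 * (N * ‖p‖)) • innerSL ℝ (z t - x)‖ ≤ ‖p‖ * (1 / 8) ^ t := by
      intro t
      induction t with
      | zero => exact ⟨p - fderiv ℝ f x, by rw [hz0]; exact hpφ, by simp [hz0]⟩
      | succ t ih =>
        obtain ⟨q, hq, hle⟩ := ih
        refine ⟨_, (hzs t).mem_subdiff hf hφ.convexOn (z t).2, ?_⟩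
        have : -(fderiv ℝ f (z t) + hess f (z t) (z (t + 1) - z t) +
            (2 * (N * ‖p‖)) • innerSL ℝ (z (t + 1) - x)) + fderiv ℝ f (z (t + 1)) +
            (2 * (N * ‖p‖)) • innerSL ℝ (z (t + 1) - x) =
            taylorResidual f (z t) (z (t + 1)) := by
          rw [taylorResidual]; abel
        rw [this]
        exact hres t q hq hle
    have hlim : Filter.Tendsto (fun t : ℕ => ‖p‖ * (1 / 8 : ℝ) ^ (t + 1)) Filter.atTop
        (nhds (‖p‖ * 0)) :=
      ((tendsto_pow_atTop_nhds_zero_of_lt_one (by norm_num) (by norm_num)).comp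
        (Filter.tendsto_add_atTop_nat 1)).const_mul _
    rw [mul_zero] at hlim
    obtain ⟨T, hT⟩ := (hlim.eventually (gt_mem_nhds
      (show 0 < 2 * N * ‖p‖ * ν / ((k : ℝ) + 1) ^ 2 by positivity))).exists
    obtain ⟨q, hq, hle⟩ := hdec T
    exact ⟨T, (hres T q hq hle).trans hT.le⟩

end Iteration

/-! ### Descent with summable errors -/

/-- A quadratic descent inequality with errors `δ j` that multiply the next iterate: the iterates
stay bounded and the decrements `e j` are summable. -/
theorem perturbed_descent {u e δ : ℕ → ℝ} {J : ℕ} (hu : ∀ j, 0 ≤ u j) (he : ∀ j, 0 ≤ e j)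
    (hδ : ∀ j, 0 ≤ δ j) (h : ∀ j < J, u (j + 1) ^ 2 + e j ≤ u j ^ 2 + 2 * δ j * u (j + 1)) :
    u J ^ 2 + ∑ i ∈ Finset.range J, e i ≤ (u 0 + 2 * ∑ i ∈ Finset.range J, δ i) ^ 2 := by
  induction J with
  | zero => simp
  | succ J ih =>
    have h1 := ih fun j hj => h j (by omega)
    have h2 := h J (by omega)
    rw [Finset.sum_range_succ, Finset.sum_range_succ]
    obtain ⟨B, hB⟩ : ∃ B, B = u 0 + 2 * ∑ i ∈ Finset.range J, δ i := ⟨_, rfl⟩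
    have hB0 : 0 ≤ B := by
      rw [hB]
      have := Finset.sum_nonneg fun i (_ : i ∈ Finset.range J) => hδ i
      linarith [hu 0]
    have hE := Finset.sum_nonneg fun i (_ : i ∈ Finset.range J) => he i
    rw [← hB] at h1
    have h3 : u (J + 1) ≤ B + 2 * δ J := by
      by_contra! hlt
      nlinarith [he J, hδ J]
    rw [mul_add, ← add_assoc (u 0), ← hB]
    nlinarith [mul_le_mul_of_nonneg_left h3 (hδ J), mul_nonneg (hδ J) hB0]

theorem sum_inv_sq_le_two (n : ℕ) : ∑ i ∈ Finset.range n, 1 / ((i : ℝ) + 1) ^ 2 ≤ 2 := by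
  have h : ∑ i ∈ Finset.range n, 1 / ((i : ℝ) + 1) ^ 2 ≤ 2 - 1 / (n : ℝ) := by
    induction n with
    | zero => simp
    | succ n ih =>
      rw [Finset.sum_range_succ]
      rcases Nat.eq_zero_or_pos n with rfl | hn
      · norm_num
      · have hn' : (0 : ℝ) < n := by exact_mod_cast hn
        have : 1 / ((n : ℝ) + 1) ^ 2 ≤ 1 / (n : ℝ) - 1 / ((n : ℝ) + 1) := by
          rw [div_sub_div _ _ hn'.ne' (by positivity), div_le_div_iff₀ (by positivity)
            (by positivity)]
          nlinarith
        push_cast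
        linarith
  have : (0 : ℝ) ≤ 1 / (n : ℝ) := by positivity
  linarith

theorem sum_div_sq_le {c : ℝ} (hc : 0 ≤ c) (n : ℕ) :
    ∑ i ∈ Finset.range n, c / ((i : ℝ) + 1) ^ 2 ≤ 2 * c := by
  have := mul_le_mul_of_nonneg_left (sum_inv_sq_le_two n) hc
  rw [Finset.mul_sum] at this
  calc _ = ∑ i ∈ Finset.range n, c * (1 / ((i : ℝ) + 1) ^ 2) := by simp [div_eq_mul_inv]
    _ ≤ _ := by linarith

theorem sum_div_sq_sq_le {c : ℝ} (n : ℕ) :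
    ∑ i ∈ Finset.range n, (c / ((i : ℝ) + 1) ^ 2) ^ 2 ≤ 2 * c ^ 2 := by
  refine (Finset.sum_le_sum fun i _ => ?_).trans (sum_div_sq_le (sq_nonneg c) n)
  have h : (1 : ℝ) ≤ (i : ℝ) + 1 := by simp
  rw [div_pow]
  gcongr
  exact le_self_pow₀ h (by norm_num)

/-! ### The Dual Newton Method -/

section DualNewton

variable {Q : Set E} {f φ : E → ℝ} {N ν : ℝ}

/-- One inexact proximal-point step, compared with a minimizer `w`. -/
theorem inexact_prox_step {h : E → ℝ} {x x' w : E} {s : E →L[ℝ] ℝ} {β δ : ℝ} (hβ : 0 < β)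
    (hs : ‖s‖ ≤ β * δ) (hsub : s - β • innerSL ℝ (x' - x) ∈ subdiff Q h x') (hw : w ∈ Q)
    (hmin : ∀ y ∈ Q, h w ≤ h y) :
    ‖x' - w‖ ^ 2 + ‖x' - x‖ ^ 2 ≤ ‖x - w‖ ^ 2 + 2 * δ * ‖x' - w‖ := by
  have h1 := hsub.2 w hw
  have h2 := hmin x' hsub.1
  have h3 : s (x' - w) ≤ β * δ * ‖x' - w‖ :=
    (le_abs_self _).trans (s.le_of_opNorm_le hs _)
  -- the subgradient at `x'` is nonnegative in the direction `x' - w`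
  have h4 : (s - β • innerSL ℝ (x' - x)) (w - x') =
      -(s (x' - w)) + β * inner ℝ (x' - x) (x' - w) := by
    rw [← neg_sub x' w, map_neg]
    simp only [sub_apply, smul_apply, innerSL_apply_apply, smul_eq_mul]
    ring
  have h5 : inner ℝ (x' - x) (x' - w) ≤ δ * ‖x' - w‖ := by
    refine le_of_mul_le_mul_left ?_ hβ
    linarith
  have h6 := norm_sub_sq_real (x' - w) (x' - x)
  rw [real_inner_comm, show x' - w - (x' - x) = x - w by abel] at h6
  linarith

theorem strongConvexOn_add (hf : ConvexOn ℝ Q f) (hsc : StrongConvexOn Q 1 φ) :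
    StrongConvexOn Q 1 (fun y => f y + φ y) := by
  have := hf.uniformConvexOn_zero.add hsc
  rwa [zero_add] at this

/-- Along a trajectory of the Dual Newton Method, the iterates are feasible and `g k` is the norm
of a subgradient. -/
theorem exists_subgradient_of_trajectory (hf : IsQuasiSelfConcordantOn Q f N)
    (hφ : ConvexOn ℝ Q φ) {x : ℕ → E} {g : ℕ → ℝ} {J : ℕ} {p : E →L[ℝ] ℝ}
    (hp : p ∈ subdiff Q (fun y => f y + φ y) (x 0)) (hg : g 0 = ‖p‖)
    (h : ∀ k < J, IsDualNewtonIteration Q f φ N ν k (x k) (g k) (x (k + 1)) (g (k + 1)))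
    {j : ℕ} (hj : j ≤ J) :
    ∃ q ∈ subdiff Q (fun y => f y + φ y) (x j), g j = ‖q‖ := by
  induction j with
  | zero => exact ⟨p, hp, hg⟩
  | succ j ih =>
    obtain ⟨q, hq, -⟩ := ih (by omega)
    obtain ⟨s, -, hs, hgs⟩ := (h j (by omega)).exists_subgradient hf hφ hq.1
    exact ⟨_, hs, hgs⟩

/-- If the method has not stopped after `J` iterations, then `J` is bounded. The squared ratios
`(g (j + 1) / g j) ^ 2` are summable, as the method is an inexact proximal-point method, while
their product is at least `(ν / g 0) ^ 2`. -/
theorem iterations_le (hf : IsQuasiSelfConcordantOn Q f N) (hN : 0 < N) (hν : 0 < ν)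
    (hφ : ConvexOn ℝ Q φ) {x : ℕ → E} {g : ℕ → ℝ} {J : ℕ} {p : E →L[ℝ] ℝ}
    (hp : p ∈ subdiff Q (fun y => f y + φ y) (x 0)) (hg : g 0 = ‖p‖)
    (h : ∀ k < J, IsDualNewtonIteration Q f φ N ν k (x k) (g k) (x (k + 1)) (g (k + 1)))
    (hpos : ∀ k ≤ J, 0 < g k) (hJ : ν < g J) {w : E} (hw : w ∈ Q)
    (hmin : ∀ y ∈ Q, f w + φ w ≤ f y + φ y) :
    (J : ℝ) ≤ 8 * N ^ 2 * ((‖x 0 - w‖ + 4 * ν) ^ 2 + 2 * ν ^ 2) + 2 * Real.log (g 0 / ν) := by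
  have hmem : ∀ j ≤ J, x j ∈ Q := fun j hj => by
    obtain ⟨q, hq, -⟩ := exists_subgradient_of_trajectory hf hφ hp hg h hj
    exact hq.1
  have hstep : ∀ j < J,
      ‖x (j + 1) - w‖ ^ 2 + ‖x (j + 1) - x j‖ ^ 2 ≤
        ‖x j - w‖ ^ 2 + 2 * (ν / ((j : ℝ) + 1) ^ 2) * ‖x (j + 1) - w‖ ∧
      g (j + 1) ≤ 2 * N * g j * (ν / ((j : ℝ) + 1) ^ 2 + ‖x (j + 1) - x j‖) := by
    intro j hj
    have hgj := hpos j hj.le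
    have hβ : 0 < 2 * N * g j := by positivity
    obtain ⟨s, hs, hsub, hgs⟩ := (h j hj).exists_subgradient hf hφ (hmem j hj.le)
    rw [mul_div_assoc] at hs
    refine ⟨inexact_prox_step hβ hs hsub hw hmin, ?_⟩
    rw [hgs, mul_add]
    refine (norm_sub_le _ _).trans (add_le_add hs ?_)
    rw [norm_smul, innerSL_apply_norm, Real.norm_of_nonneg hβ.le]
  have hsum : ∑ i ∈ Finset.range J, ‖x (i + 1) - x i‖ ^ 2 ≤ (‖x 0 - w‖ + 4 * ν) ^ 2 := by
    have h1 := perturbed_descent (u := fun j => ‖x j - w‖) (e := fun j => ‖x (j + 1) - x j‖ ^ 2)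
      (δ := fun j => ν / ((j : ℝ) + 1) ^ 2) (J := J) (fun _ => norm_nonneg _)
      (fun _ => sq_nonneg _) (fun _ => by positivity) fun j hj => (hstep j hj).1
    have h2 := sum_div_sq_le hν.le J
    have h3 : 0 ≤ ∑ i ∈ Finset.range J, ν / ((i : ℝ) + 1) ^ 2 :=
      Finset.sum_nonneg fun _ _ => by positivity
    refine (le_trans (le_add_of_nonneg_left (sq_nonneg _)) h1).trans ?_
    gcongr ?_ ^ 2
    linarith
  have hlog : ∀ j < J, 2 * (Real.log (g (j + 1)) - Real.log (g j)) ≤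
      8 * N ^ 2 * (‖x (j + 1) - x j‖ ^ 2 + (ν / ((j : ℝ) + 1) ^ 2) ^ 2) - 1 := by
    intro j hj
    have h1 := hpos j hj.le
    have h2 := hpos (j + 1) hj
    have h3 := Real.log_le_sub_one_of_pos (x := (g (j + 1) / g j) ^ 2) (by positivity)
    rw [Real.log_pow, Real.log_div h2.ne' h1.ne'] at h3
    have h4 : g (j + 1) / g j ≤ 2 * N * (ν / ((j : ℝ) + 1) ^ 2 + ‖x (j + 1) - x j‖) := by
      rw [div_le_iff₀ h1]
      linarith [(hstep j hj).2]
    have h5 := pow_le_pow_left₀ (by positivity) h4 2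
    have h6 : 0 ≤ 4 * N ^ 2 * (ν / ((j : ℝ) + 1) ^ 2 - ‖x (j + 1) - x j‖) ^ 2 := by positivity
    push_cast at h3
    linarith
  -- the left-hand sides telescope to `2 (log (g J) - log (g 0))`
  have htel := Finset.sum_le_sum fun j (hj : j ∈ Finset.range J) =>
    hlog j (Finset.mem_range.1 hj)
  rw [← Finset.mul_sum, Finset.sum_range_sub (fun j => Real.log (g j)), Finset.sum_sub_distrib,
    ← Finset.mul_sum, Finset.sum_add_distrib] at htel
  simp only [Finset.sum_const, Finset.card_range, nsmul_eq_mul, mul_one] at htel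
  have h7 := Real.log_lt_log hν hJ
  rw [Real.log_div (hpos 0 (Nat.zero_le _)).ne' hν.ne']
  have h8 : 8 * N ^ 2 * (∑ i ∈ Finset.range J, ‖x (i + 1) - x i‖ ^ 2 +
      ∑ i ∈ Finset.range J, (ν / ((i : ℝ) + 1) ^ 2) ^ 2) ≤
      8 * N ^ 2 * ((‖x 0 - w‖ + 4 * ν) ^ 2 + 2 * ν ^ 2) := by
    gcongr
    exact sum_div_sq_sq_le J
  linarith

theorem exists_minimizer [FiniteDimensional ℝ E] (hf : IsQuasiSelfConcordantOn Q f N)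
    (hφ : IsClosedConvexProper Q φ) (hsc : StrongConvexOn Q 1 φ) {x : E} {p : E →L[ℝ] ℝ}
    (hp : p ∈ subdiff Q (fun y => f y + φ y) x) :
    ∃ w ∈ Q, ∀ y ∈ Q, f w + φ w ≤ f y + φ y := by
  refine exists_forall_add_le hφ hsc
    (fun y hy => (hf.differentiableAt hy).continuousAt.continuousWithinAt)
    (sub_mem_subdiff hφ.convexOn (hf.differentiableAt hp.1).hasFDerivAt hp)
    (ℓ := fderiv ℝ f x) (c := f x - fderiv ℝ f x x) fun y hy => ?_
  have h1 := (fderiv_mem_subdiff hf.convexOn hp.1 (hf.differentiableAt hp.1)).2 y hy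
  rw [map_sub] at h1
  linarith

/-- A vanishing subgradient makes the method stop at once. -/
theorem IsDualNewtonIteration.eq_zero (hf : IsQuasiSelfConcordantOn Q f N)
    (hφ : ConvexOn ℝ Q φ) {x x' : E} {g' : ℝ} {k : ℕ} (hx : x ∈ Q)
    (h : IsDualNewtonIteration Q f φ N ν k x 0 x' g') : g' = 0 := by
  obtain ⟨s, hs, -, rfl⟩ := h.exists_subgradient hf hφ hx
  simpa using hs

theorem exists_dualNewtonReturns [FiniteDimensional ℝ E] (hf : IsQuasiSelfConcordantOn Q f N)
    (hN : 0 < N) (hν : 0 < ν) (hφ : IsClosedConvexProper Q φ) (hsc : StrongConvexOn Q 1 φ)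
    {x₀ : E} {p : E →L[ℝ] ℝ} (hp : p ∈ subdiff Q (fun y => f y + φ y) x₀) :
    ∃ xbar I, DualNewtonReturns Q f φ x₀ N ν p xbar I := by
  obtain ⟨w, hw, hmin⟩ := exists_minimizer hf hφ hsc hp
  have hnext : ∀ (k : ℕ) (st : {st : E × ℝ // ∃ q ∈ subdiff Q (fun y => f y + φ y) st.1,
      st.2 = ‖q‖}), ∃ st' : {st : E × ℝ // ∃ q ∈ subdiff Q (fun y => f y + φ y) st.1,
      st.2 = ‖q‖}, IsDualNewtonIteration Q f φ N ν k st.1.1 st.1.2 st'.1.1 st'.1.2 := by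
    rintro k ⟨⟨x, g⟩, q, hq, hg⟩
    obtain rfl : g = ‖q‖ := hg
    obtain ⟨x', g', h⟩ := exists_isDualNewtonIteration hf hN hφ hsc hν hq k
    obtain ⟨s, -, hs, hgs⟩ := h.exists_subgradient hf hφ.convexOn hq.1
    exact ⟨⟨(x', g'), _, hs, hgs⟩, h⟩
  choose next hnext using hnext
  -- the trajectory that ignores the stopping criterion
  obtain ⟨S, hS⟩ : ∃ S : ℕ → {st : E × ℝ // ∃ q ∈ subdiff Q (fun y => f y + φ y) st.1,
      st.2 = ‖q‖}, S = fun n => Nat.rec ⟨(x₀, ‖p‖), p, hp, rfl⟩ next n := ⟨_, rfl⟩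
  have hS0 : (S 0).1 = (x₀, ‖p‖) := by subst hS; rfl
  have hSs : ∀ k, IsDualNewtonIteration Q f φ N ν k (S k).1.1 (S k).1.2 (S (k + 1)).1.1
      (S (k + 1)).1.2 := fun k => by
    have : S (k + 1) = next k (S k) := by subst hS; rfl
    rw [this]
    exact hnext k _
  have hfin : ∃ j, (S (j + 1)).1.2 ≤ ν := by
    by_contra! hcon
    have h0 : 0 < (S 0).1.2 := by
      rw [hS0]
      refine (norm_nonneg p).lt_of_ne' fun h0 => ?_
      have h1 := hSs 0
      have h2 := hcon 0
      rw [hS0, h0] at h1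
      rw [h1.eq_zero hf hφ.convexOn hp.1] at h2
      exact lt_asymm hν h2
    have hpos : ∀ k, 0 < (S k).1.2 := fun k => by
      cases k with
      | zero => exact h0
      | succ k => exact hν.trans (hcon k)
    obtain ⟨J, hJ⟩ := exists_nat_gt (8 * N ^ 2 * ((‖(S 0).1.1 - w‖ + 4 * ν) ^ 2 + 2 * ν ^ 2) +
      2 * Real.log ((S 0).1.2 / ν))
    have h1 := iterations_le (x := fun k => (S k).1.1) (g := fun k => (S k).1.2) (J := J + 1)
      hf hN hν hφ.convexOn (by rw [hS0]; exact hp) (by rw [hS0]) (fun k _ => hSs k)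
      (fun k _ => hpos k) (hcon J) hw hmin
    push_cast at h1
    linarith
  classical
  refine ⟨_, Nat.find hfin + 1, hp, fun k => (S k).1.1, fun k => (S k).1.2,
    congrArg Prod.fst hS0, congrArg Prod.snd hS0, by omega, fun k _ => hSs k,
    fun k hk => not_le.1 (Nat.find_min hfin (by omega)),
    Nat.find_spec hfin, rfl⟩

theorem DualNewtonReturns.unique (hf : IsQuasiSelfConcordantOn Q f N)
    (hN : 0 < N) (hφ : ConvexOn ℝ Q φ) (hsc : StrongConvexOn Q 1 φ)
    {x₀ xbar xbar' : E} {p : E →L[ℝ] ℝ} {I I' : ℕ}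
    (h : DualNewtonReturns Q f φ x₀ N ν p xbar I)
    (h' : DualNewtonReturns Q f φ x₀ N ν p xbar' I') : xbar = xbar' ∧ I = I' := by
  obtain ⟨hp, x, g, hx0, hg0, hI1, hit, hgt, hle, rfl⟩ := h
  obtain ⟨-, x', g', hx0', hg0', hI1', hit', hgt', hle', rfl⟩ := h'
  have heq : ∀ k, k ≤ I → k ≤ I' → x k = x' k ∧ g k = g' k := by
    intro k
    induction k with
    | zero => exact fun _ _ => ⟨hx0.trans hx0'.symm, hg0.trans hg0'.symm⟩
    | succ k ih =>
      intro h1 h2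
      obtain ⟨e1, e2⟩ := ih (by omega) (by omega)
      have h3 := hit' k (by omega)
      rw [← e1, ← e2] at h3
      obtain ⟨q, hq, hgq⟩ := exists_subgradient_of_trajectory hf hφ (hx0 ▸ hp) hg0 hit
        (show k ≤ I by omega)
      exact (hit k (by omega)).unique hf hN hφ hsc hq.1 (hgq ▸ norm_nonneg q) h3
  have hII : I = I' := by
    rcases lt_trichotomy I I' with hlt | heq' | hlt
    · obtain ⟨k, rfl⟩ : ∃ k, I = k + 1 := ⟨I - 1, by omega⟩
      have := hgt' k hlt
      rw [← (heq (k + 1) le_rfl hlt.le).2] at this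
      exact absurd hle (not_le.2 this)
    · exact heq'
    · obtain ⟨k, rfl⟩ : ∃ k, I' = k + 1 := ⟨I' - 1, by omega⟩
      have := hgt k hlt
      rw [(heq (k + 1) hlt.le le_rfl).2] at this
      exact absurd hle' (not_le.2 this)
  subst hII
  exact ⟨(heq I le_rfl le_rfl).1, rfl⟩

theorem DualNewtonReturns.exists_subgradient (hf : IsQuasiSelfConcordantOn Q f N)
    (hφ : ConvexOn ℝ Q φ) {x₀ xbar : E} {p : E →L[ℝ] ℝ} {I : ℕ}
    (h : DualNewtonReturns Q f φ x₀ N ν p xbar I) :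
    ∃ q ∈ subdiff Q (fun y => f y + φ y) xbar, ‖q‖ ≤ ν := by
  obtain ⟨hp, x, g, hx0, hg0, -, hit, -, hle, rfl⟩ := h
  obtain ⟨q, hq, hgq⟩ := exists_subgradient_of_trajectory hf hφ (hx0 ▸ hp) hg0 hit le_rfl
  exact ⟨q, hq, hgq ▸ hle⟩

/-- The number of iterations of the Dual Newton Method, in terms of the distance between the
initial and the returned point: by strong convexity, the latter is `ν`-close to the minimizer. -/
theorem DualNewtonReturns.iterations_le [FiniteDimensional ℝ E]
    (hf : IsQuasiSelfConcordantOn Q f N) (hN : 0 < N) (hν : 0 < ν)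
    (hφ : IsClosedConvexProper Q φ) (hsc : StrongConvexOn Q 1 φ)
    {x₀ xbar : E} {p : E →L[ℝ] ℝ} {I : ℕ} (h : DualNewtonReturns Q f φ x₀ N ν p xbar I) :
    (I : ℝ) ≤ 1 + 16 * N ^ 2 * (‖xbar - x₀‖ ^ 2 + 26 * ν ^ 2) +
      2 * max 0 (Real.log (‖p‖ / ν)) := by
  obtain ⟨w, hw, hmin⟩ := exists_minimizer hf hφ hsc h.1
  obtain ⟨q, hq, hqν⟩ := h.exists_subgradient hf hφ.convexOn
  have hdist : ‖xbar - w‖ ≤ ν := by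
    have h1 := subdiff_monotone (strongConvexOn_add hf.convexOn hsc)
      (p := 0) ⟨hw, fun y hy => by simpa using hmin y hy⟩ hq
    rw [sub_zero] at h1
    have h2 := (le_abs_self _).trans (q.le_of_opNorm_le hqν (xbar - w))
    by_contra! hlt
    nlinarith
  have hD : ‖x₀ - w‖ ≤ ‖xbar - x₀‖ + ν := by
    rw [norm_sub_rev xbar x₀]
    exact (norm_sub_le_norm_sub_add_norm_sub x₀ xbar w).trans (by gcongr)
  obtain ⟨hp, x, g, hx0, hg0, hI1, hit, hgt, hle, rfl⟩ := h
  obtain ⟨J, rfl⟩ : ∃ J, I = J + 1 := ⟨I - 1, by omega⟩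
  have hmax0 : 0 ≤ max 0 (Real.log (‖p‖ / ν)) := le_max_left _ _
  have hmax1 : Real.log (‖p‖ / ν) ≤ max 0 (Real.log (‖p‖ / ν)) := le_max_right _ _
  push_cast
  cases J with
  | zero =>
    have : 0 ≤ 16 * N ^ 2 * (‖x (0 + 1) - x₀‖ ^ 2 + 26 * ν ^ 2) := by positivity
    push_cast
    linarith
  | succ J =>
    have hg0pos : 0 < g 0 := by
      rw [hg0]
      refine (norm_nonneg p).lt_of_ne' fun h0 => ?_
      have h1 := hit 0 (by omega)
      have h2 := hgt 0 (by omega)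
      rw [hg0, h0] at h1
      rw [h1.eq_zero hf hφ.convexOn (hx0 ▸ hp.1)] at h2
      exact lt_asymm hν h2
    have hpos : ∀ k ≤ J + 1, 0 < g k := fun k hk => by
      cases k with
      | zero => exact hg0pos
      | succ k => exact hν.trans (hgt k (by omega))
    have h1 := QSCNewton.iterations_le (J := J + 1) hf hN hν hφ.convexOn (hx0 ▸ hp) hg0
      (fun k hk => hit k (by omega)) hpos (hgt J (by omega)) hw hmin
    rw [hg0, hx0] at h1
    have h2 : 8 * N ^ 2 * ((‖x₀ - w‖ + 4 * ν) ^ 2 + 2 * ν ^ 2) ≤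
        16 * N ^ 2 * (‖x (J + 1 + 1) - x₀‖ ^ 2 + 26 * ν ^ 2) := by
      have h3 : (‖x₀ - w‖ + 4 * ν) ^ 2 ≤ (‖x (J + 1 + 1) - x₀‖ + 5 * ν) ^ 2 := by
        gcongr ?_ ^ 2
        linarith
      have h4 : (‖x₀ - w‖ + 4 * ν) ^ 2 + 2 * ν ^ 2 ≤
          2 * (‖x (J + 1 + 1) - x₀‖ ^ 2 + 26 * ν ^ 2) := by
        nlinarith [sq_nonneg (‖x (J + 1 + 1) - x₀‖ - 5 * ν)]
      have := mul_le_mul_of_nonneg_left h4 (show 0 ≤ 8 * N ^ 2 by positivity)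
      linarith
    linarith

end DualNewton

/-! ### The contracted subproblem of the accelerated scheme -/

section Contraction

theorem hasFDerivAt_comp_contraction {G : Type*} [NormedAddCommGroup G] [NormedSpace ℝ G]
    {F : E → G} {F' : E →L[ℝ] G} {γ : ℝ} {b x : E} (h : HasFDerivAt F F' (γ • x + b)) (a : ℝ) :
    HasFDerivAt (fun y => a • F (γ • y + b)) ((a * γ) • F') x := by
  have h1 : HasFDerivAt (fun y : E => γ • y + b) (γ • ContinuousLinearMap.id ℝ E) x :=
    ((hasFDerivAt_id x).const_smul γ).add_const b
  have h2 := (HasFDerivAt.comp (f := fun y : E => γ • y + b) x h h1).const_smul a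
  refine h2.congr_fderiv ?_
  ext w
  simp [mul_smul]

variable {f : E → ℝ} {a γ : ℝ} {b x : E}

theorem fderiv_contraction (h : ContDiffAt ℝ 3 f (γ • x + b)) :
    fderiv ℝ (fun y => a * f (γ • y + b)) x = (a * γ) • fderiv ℝ f (γ • x + b) :=
  (hasFDerivAt_comp_contraction (h.differentiableAt (by norm_num)).hasFDerivAt a).fderiv

theorem eventually_contDiffAt_contraction (h : ContDiffAt ℝ 3 f (γ • x + b)) :
    ∀ᶠ y in nhds x, ContDiffAt ℝ 3 f (γ • y + b) :=
  (Continuous.continuousAt (by fun_prop)).eventually (h.eventually (by simp))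

theorem hess_contraction (h : ContDiffAt ℝ 3 f (γ • x + b)) :
    hess (fun y => a * f (γ • y + b)) x = (a * γ * γ) • hess f (γ • x + b) := by
  have h1 : fderiv ℝ (fun y => a * f (γ • y + b)) =ᶠ[nhds x]
      fun y => (a * γ) • fderiv ℝ f (γ • y + b) :=
    (eventually_contDiffAt_contraction h).mono fun y hy => fderiv_contraction hy
  rw [hess, h1.fderiv_eq]
  exact (hasFDerivAt_comp_contraction (((h.fderiv_right (m := 2) (by norm_num)).differentiableAt
    (by norm_num)).hasFDerivAt) (a * γ)).fderiv

theorem thirdDeriv_contraction (h : ContDiffAt ℝ 3 f (γ • x + b)) (u v : E) :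
    thirdDeriv (fun y => a * f (γ • y + b)) x u v =
      a * γ * γ * γ * thirdDeriv f (γ • x + b) u v := by
  have h1 : hess (fun y => a * f (γ • y + b)) =ᶠ[nhds x]
      fun y => (a * γ * γ) • hess f (γ • y + b) :=
    (eventually_contDiffAt_contraction h).mono fun y hy => hess_contraction hy
  have h2 : HasFDerivAt (hess f) (fderiv ℝ (hess f) (γ • x + b)) (γ • x + b) :=
    (((h.fderiv_right (m := 2) (by norm_num)).fderiv_right (m := 1)
      (by norm_num)).differentiableAt (by norm_num)).hasFDerivAt
  have h3 : fderiv ℝ (fun y => (a * γ * γ) • hess f (γ • y + b)) x =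
      (a * γ * γ * γ) • fderiv ℝ (hess f) (γ • x + b) :=
    (hasFDerivAt_comp_contraction (G := E →L[ℝ] E →L[ℝ] ℝ) h2 (a * γ * γ)).fderiv
  rw [thirdDeriv, h1.fderiv_eq, h3]
  simp [thirdDeriv]

end Contraction

section Subproblem

variable {Q : Set E} {f ψ : E → ℝ} {M R A₀ γ : ℝ} {k : ℕ} {xk vk : E}

theorem accA_pos (hA : 0 < A₀) (hγ : γ < 1) (k : ℕ) : 0 < accA A₀ γ k :=
  div_pos hA (pow_pos (by linarith) _)

theorem accA_succ_mul (hγ : γ < 1) (k : ℕ) : accA A₀ γ (k + 1) * (1 - γ) = accA A₀ γ k := by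
  have h : (1 - γ) ≠ 0 := by linarith
  rw [accA, accA, pow_succ]
  field_simp

theorem accA_coeff (hγ : γ < 1) (k : ℕ) :
    γ / (1 - γ) * accA A₀ γ k = γ * accA A₀ γ (k + 1) := by
  have h : (1 - γ) ≠ 0 := by linarith
  rw [← accA_succ_mul hγ k]
  field_simp

theorem convex_comb_mem (hQ : Convex ℝ Q) (hγ0 : 0 < γ) (hγ : γ < 1) {x y : E} (hx : x ∈ Q)
    (hy : y ∈ Q) : γ • x + (1 - γ) • y ∈ Q :=
  hQ hx hy hγ0.le (by linarith) (by ring)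

/-- The contraction scales the Quasi-Self-Concordance parameter by `γ`. -/
theorem isQuasiSelfConcordantOn_accSmooth (hf : IsQuasiSelfConcordantOn Q f M) (hA : 0 < A₀)
    (hγ0 : 0 < γ) (hγ : γ < 1) (hxk : xk ∈ Q) :
    IsQuasiSelfConcordantOn Q (accSmooth f A₀ γ k xk) (γ * M) := by
  have hA' := accA_pos hA hγ (k + 1)
  have hmem : ∀ x ∈ Q, γ • x + (1 - γ) • xk ∈ Q := fun x hx =>
    convex_comb_mem hf.convexOn.1 hγ0 hγ hx hxk
  refine ⟨⟨hf.convexOn.1, fun x hx y hy s t hs ht hst => ?_⟩, fun x hx => ?_, fun x hx u v => ?_⟩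
  · have h := hf.convexOn.2 (hmem x hx) (hmem y hy) hs ht hst
    have he : s • (γ • x + (1 - γ) • xk) + t • (γ • y + (1 - γ) • xk) =
        γ • (s • x + t • y) + (1 - γ) • xk := by
      obtain rfl : s = 1 - t := by linarith
      module
    rw [he] at h
    have := mul_le_mul_of_nonneg_left h hA'.le
    simp only [accSmooth, smul_eq_mul] at this ⊢
    linarith
  · have h1 : ContDiffAt ℝ 3 (fun y : E => γ • y + (1 - γ) • xk) x := by fun_prop
    exact contDiffAt_const.mul
      (ContDiffAt.comp (f := fun y : E => γ • y + (1 - γ) • xk) x (hf.contDiffAt _ (hmem x hx)) h1)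
  · have hc := hf.contDiffAt _ (hmem x hx)
    have h1 := thirdDeriv_contraction (a := accA A₀ γ (k + 1)) hc u v
    have h2 := hess_contraction (a := accA A₀ γ (k + 1)) hc
    have h3 := hf.thirdDeriv_le _ (hmem x hx) u v
    change thirdDeriv (fun y => accA A₀ γ (k + 1) * f (γ • y + (1 - γ) • xk)) x u v ≤
      γ * M * hess (fun y => accA A₀ γ (k + 1) * f (γ • y + (1 - γ) • xk)) x u u * ‖v‖
    rw [h1, h2]
    have h4 := mul_le_mul_of_nonneg_left h3
      (show 0 ≤ accA A₀ γ (k + 1) * γ * γ * γ by positivity)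
    simp only [smul_apply, smul_eq_mul]
    linarith

theorem coeff_pos (hA : 0 < A₀) (hγ0 : 0 < γ) (hγ : γ < 1) (k : ℕ) :
    0 < γ / (1 - γ) * accA A₀ γ k :=
  mul_pos (div_pos hγ0 (by linarith)) (accA_pos hA hγ k)

theorem convexOn_const_mul {a : ℝ} (ha : 0 ≤ a) (hψ : ConvexOn ℝ Q ψ) :
    ConvexOn ℝ Q (fun y => a * ψ y) := by
  simpa using! hψ.smul ha

theorem strongConvexOn_accComposite (hψ : ConvexOn ℝ Q ψ) (hA : 0 < A₀)
    (hγ0 : 0 < γ) (hγ : γ < 1) : StrongConvexOn Q 1 (accComposite ψ A₀ γ k vk) := by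
  refine ⟨hψ.1, fun x hx y hy s t hs ht hst => ?_⟩
  have h := (convexOn_const_mul (coeff_pos hA hγ0 hγ k).le hψ).2 hx hy hs ht hst
  have h2 : ‖s • x + t • y - vk‖ ^ 2 =
      s * ‖x - vk‖ ^ 2 + t * ‖y - vk‖ ^ 2 - s * t * ‖x - y‖ ^ 2 := by
    rw [show s • x + t • y - vk = s • (x - vk) + t • (y - vk) by
        obtain rfl : s = 1 - t := by linarith
        module,
      show x - y = (x - vk) - (y - vk) by abel, norm_add_sq_real, norm_sub_sq_real (x - vk),
      norm_smul, norm_smul, real_inner_smul_left, real_inner_smul_right,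
      Real.norm_of_nonneg hs, Real.norm_of_nonneg ht]
    obtain rfl : s = 1 - t := by linarith
    ring
  simp only [accComposite, smul_eq_mul] at h ⊢
  rw [h2]
  linarith

theorem isClosedConvexProper_accComposite (hψ : IsClosedConvexProper Q ψ) (hA : 0 < A₀)
    (hγ0 : 0 < γ) (hγ : γ < 1) : IsClosedConvexProper Q (accComposite ψ A₀ γ k vk) := by
  have ha := coeff_pos hA hγ0 hγ k
  refine ⟨hψ.nonempty,
    (strongConvexOn_accComposite hψ.convexOn hA hγ0 hγ).convexOn (fun r => ?_), ?_⟩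
  · simp only [Pi.zero_apply]; positivity
  · have hcont : Continuous fun w : E × ℝ =>
        (w.1, (w.2 - 1 / 2 * ‖w.1 - vk‖ ^ 2) / (γ / (1 - γ) * accA A₀ γ k)) := by fun_prop
    convert hψ.isClosed_epigraph.preimage hcont using 1
    ext w
    simp only [accComposite, mem_ofPred_eq, mem_preimage, le_div_iff₀ ha]
    refine and_congr_right fun _ => ?_
    constructor <;> intro h <;> linarith

theorem const_mul_mem_subdiff {a : ℝ} (ha : 0 ≤ a) {p : E →L[ℝ] ℝ} {x : E}
    (hp : p ∈ subdiff Q ψ x) : a • p ∈ subdiff Q (fun y => a * ψ y) x := by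
  refine ⟨hp.1, fun y hy => ?_⟩
  have := mul_le_mul_of_nonneg_left (hp.2 y hy) ha
  simp only [smul_apply, smul_eq_mul]
  linarith

theorem inv_smul_mem_subdiff {a : ℝ} (ha : 0 < a) {p : E →L[ℝ] ℝ} {x : E}
    (hp : p ∈ subdiff Q (fun y => a * ψ y) x) : a⁻¹ • p ∈ subdiff Q ψ x := by
  have := const_mul_mem_subdiff (inv_nonneg.2 ha.le) hp
  simpa [← mul_assoc, inv_mul_cancel₀ ha.ne'] using this

/-- A subgradient of `ψ` at the prox-center `v_k` gives one of the subproblem. -/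
theorem subproblem_subdiff_nonempty (hf : IsQuasiSelfConcordantOn Q f M) (hA : 0 < A₀)
    (hγ0 : 0 < γ) (hγ : γ < 1) (hxk : xk ∈ Q) (h : (subdiff Q ψ vk).Nonempty) :
    (subdiff Q (fun y => accSmooth f A₀ γ k xk y + accComposite ψ A₀ γ k vk y) vk).Nonempty := by
  obtain ⟨p, hp⟩ := h
  have hq := isQuasiSelfConcordantOn_accSmooth (k := k) hf hA hγ0 hγ hxk
  have h1 := fderiv_mem_subdiff hq.convexOn hp.1 (hq.differentiableAt hp.1)
  refine ⟨_, add_mem_subdiff h1 (q := (γ / (1 - γ) * accA A₀ γ k) • p) ⟨hp.1, fun y hy => ?_⟩⟩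
  have h2 := (const_mul_mem_subdiff (coeff_pos hA hγ0 hγ k).le hp).2 y hy
  simp only [accComposite, sub_self, norm_zero]
  have h3 := sq_nonneg ‖y - vk‖
  linarith

theorem exists_subdiff_of_subproblem (hf : IsQuasiSelfConcordantOn Q f M)
    (hψ : ConvexOn ℝ Q ψ) (hA : 0 < A₀) (hγ0 : 0 < γ) (hγ : γ < 1) (hxk : xk ∈ Q) {x : E}
    {p : E →L[ℝ] ℝ}
    (hp : p ∈ subdiff Q (fun y => accSmooth f A₀ γ k xk y + accComposite ψ A₀ γ k vk y) x) :
    ∃ q ∈ subdiff Q ψ x,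
      p = (γ * accA A₀ γ (k + 1)) • (fderiv ℝ f (γ • x + (1 - γ) • xk) + q) +
        innerSL ℝ (x - vk) := by
  have ha := coeff_pos hA hγ0 hγ k
  have hc := hf.contDiffAt _ (convex_comb_mem hf.convexOn.1 hγ0 hγ hp.1 hxk)
  have h1 := hasFDerivAt_comp_contraction (hc.differentiableAt (by norm_num)).hasFDerivAt
    (accA A₀ γ (k + 1))
  have h2 := (((hasFDerivAt_id (𝕜 := ℝ) x).sub_const vk).norm_sq).const_mul (1 / 2)
  have h3 := sub_mem_subdiff (convexOn_const_mul ha.le hψ) (h1.add h2) (p := p)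
    ⟨hp.1, fun y hy => by
      have := hp.2 y hy
      simp only [accSmooth, accComposite] at this
      simp only [Pi.add_apply, id, smul_eq_mul]
      linarith⟩
  refine ⟨_, inv_smul_mem_subdiff ha h3, ?_⟩
  rw [smul_add, accA_coeff hγ, smul_smul, mul_inv_cancel₀ (by rw [← accA_coeff hγ]; exact ha.ne')]
  ext w
  simp
  ring

/-- Decrease of the potential `2 A_k (F(x_k) - F⋆) + ‖v_k - x⋆‖²` in one iteration. -/
theorem InnerCallReturns.potential_le (hf : IsQuasiSelfConcordantOn Q f M)
    (hψ : ConvexOn ℝ Q ψ) (hA : 0 < A₀) (hγ0 : 0 < γ) (hγ : γ < 1)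
    (hxk : xk ∈ Q) {p : E →L[ℝ] ℝ} {v' xs : E} {I : ℕ} (hxs : xs ∈ Q)
    (h : InnerCallReturns Q f ψ M R A₀ γ k xk vk p v' I) :
    2 * accA A₀ γ (k + 1) * ((f (γ • v' + (1 - γ) • xk) + ψ (γ • v' + (1 - γ) • xk)) -
        (f xs + ψ xs)) + ‖v' - xs‖ ^ 2 + ‖v' - vk‖ ^ 2 ≤
      2 * accA A₀ γ k * ((f xk + ψ xk) - (f xs + ψ xs)) + ‖vk - xs‖ ^ 2 +
        2 * (R / ((k : ℝ) + 1) ^ 2) * ‖v' - xs‖ := by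
  have hq := isQuasiSelfConcordantOn_accSmooth (k := k) hf hA hγ0 hγ hxk
  have hsc := strongConvexOn_accComposite (k := k) (vk := vk) hψ hA hγ0 hγ
  obtain ⟨q, hqs, hqν⟩ := h.exists_subgradient hq (hsc.convexOn fun r => by
    simp only [Pi.zero_apply]; positivity)
  have h1 := subdiff_strong (strongConvexOn_add hq.convexOn hsc) hqs hxs
  have h2 := (neg_le_abs _).trans (q.le_of_opNorm_le hqν (xs - v'))
  have h3 := hf.convexOn.2 hxs hxk hγ0.le (show 0 ≤ 1 - γ by linarith) (by ring)
  have h4 := hψ.2 hqs.1 hxk hγ0.le (show 0 ≤ 1 - γ by linarith) (by ring)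
  have hA' := accA_pos hA hγ (k + 1)
  have h5 := mul_le_mul_of_nonneg_left h3 hA'.le
  have h6 := mul_le_mul_of_nonneg_left h4 hA'.le
  simp only [accSmooth, accComposite, accA_coeff hγ, smul_eq_mul] at h1 h5 h6
  rw [norm_sub_rev xs v'] at h1 h2
  rw [norm_sub_rev xs vk] at h1
  rw [← accA_succ_mul hγ k]
  linarith

end Subproblem

/-! ### Runs of the accelerated scheme -/

section Run

variable {Q : Set E} {f ψ : E → ℝ} {M R A₀ γ : ℝ} {x₀ xs : E} {x v : ℕ → E} {I : ℕ → ℕ}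

theorem IsAcceleratedNewtonRun.mem (hf : IsQuasiSelfConcordantOn Q f M)
    (hψ : ConvexOn ℝ Q ψ) (hA : 0 < A₀) (hγ0 : 0 < γ) (hγ : γ < 1)
    (h₀ : (subdiff Q (fun y => f y + ψ y) x₀).Nonempty) {n : ℕ∞}
    (h : IsAcceleratedNewtonRun Q f ψ M R A₀ γ x₀ n x v I) (k : ℕ) (hk : (k : ℕ∞) ≤ n) :
    x k ∈ Q ∧ (subdiff Q ψ (v k)).Nonempty := by
  obtain ⟨hx0, hv0, hstep⟩ := h
  induction k with
  | zero =>
    obtain ⟨p, hp⟩ := h₀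
    rw [hx0, hv0]
    exact ⟨hp.1, _, sub_mem_subdiff hψ (hf.differentiableAt hp.1).hasFDerivAt hp⟩
  | succ k ih =>
    have hlt : (k : ℕ∞) < n := lt_of_lt_of_le (by exact_mod_cast Nat.lt_succ_self k) hk
    obtain ⟨hxk, -⟩ := ih hlt.le
    obtain ⟨⟨p, hp⟩, hx⟩ := hstep k hlt
    have hsc := strongConvexOn_accComposite (k := k) (vk := v k) hψ hA hγ0 hγ
    obtain ⟨q, hq, -⟩ := DualNewtonReturns.exists_subgradient
      (isQuasiSelfConcordantOn_accSmooth (k := k) hf hA hγ0 hγ hxk)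
      (hsc.convexOn fun r => by simp only [Pi.zero_apply]; positivity) hp
    obtain ⟨q', hq', -⟩ := exists_subdiff_of_subproblem hf hψ hA hγ0 hγ hxk hq
    rw [hx]
    exact ⟨convex_comb_mem hψ.1 hγ0 hγ hq'.1 hxk, q', hq'⟩

/-- The potential stays bounded along a run, and the displacements `v_{k+1} - v_k` are
square-summable. The errors `R / (k + 1) ^ 2` sum to at most `2 R`, hence the radius
`(1 + c) R + 4 R = (5 + c) R`. -/
theorem IsAcceleratedNewtonRun.potential_le (hf : IsQuasiSelfConcordantOn Q f M)
    (hψ : ConvexOn ℝ Q ψ) (hA : 0 < A₀) (hγ0 : 0 < γ) (hγ : γ < 1) (hR : 0 < R)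
    (h₀ : (subdiff Q (fun y => f y + ψ y) x₀).Nonempty) (hxs : xs ∈ Q)
    (hmin : ∀ y ∈ Q, f xs + ψ xs ≤ f y + ψ y)
    (h : IsAcceleratedNewtonRun Q f ψ M R A₀ γ x₀ ⊤ x v I) {c : ℝ} (hc : 0 < c)
    (h0R : ‖x₀ - xs‖ ≤ R)
    (hA0 : 2 * A₀ * ((f x₀ + ψ x₀) - (f xs + ψ xs)) = c ^ 2 * R ^ 2) (J : ℕ) :
    2 * accA A₀ γ J * ((f (x J) + ψ (x J)) - (f xs + ψ xs)) + ‖v J - xs‖ ^ 2 +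
      ∑ i ∈ Finset.range J, ‖v (i + 1) - v i‖ ^ 2 ≤ ((5 + c) * R) ^ 2 := by
  have hmem := fun k => h.mem hf hψ hA hγ0 hγ h₀ k le_top
  obtain ⟨P, hP⟩ : ∃ P : ℕ → ℝ, P = fun k =>
    2 * accA A₀ γ k * ((f (x k) + ψ (x k)) - (f xs + ψ xs)) + ‖v k - xs‖ ^ 2 := ⟨_, rfl⟩
  have hgap : ∀ k, 0 ≤ 2 * accA A₀ γ k * ((f (x k) + ψ (x k)) - (f xs + ψ xs)) := fun k => by
    have h1 := accA_pos hA hγ k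
    have h2 := sub_nonneg.2 (hmin _ (hmem k).1)
    positivity
  have hv : ∀ k, ‖v k - xs‖ ^ 2 ≤ P k := fun k => by
    simp only [hP]; linarith [hgap k]
  have hP0 : ∀ k, 0 ≤ P k := fun k => (sq_nonneg _).trans (hv k)
  have hmain := perturbed_descent (u := fun k => √(P k)) (e := fun k => ‖v (k + 1) - v k‖ ^ 2)
    (δ := fun k => R / ((k : ℝ) + 1) ^ 2) (J := J) (fun _ => Real.sqrt_nonneg _)
    (fun _ => sq_nonneg _) (fun _ => by positivity) (fun k _ => by
      obtain ⟨⟨p, hp⟩, hx⟩ := h.2.2 k (by exact_mod_cast ENat.natCast_lt_top k)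
      have h1 := hp.potential_le hf hψ hA hγ0 hγ (hmem k).1 hxs
      rw [← hx] at h1
      have h2 : ‖v (k + 1) - xs‖ ≤ √(P (k + 1)) := Real.le_sqrt_of_sq_le (hv _)
      have h3 : 2 * (R / ((k : ℝ) + 1) ^ 2) * ‖v (k + 1) - xs‖ ≤
        2 * (R / ((k : ℝ) + 1) ^ 2) * √(P (k + 1)) := by gcongr
      simp only [Real.sq_sqrt (hP0 _)]
      rw [hP]
      simp only at h1 ⊢
      rw [hP] at h3
      linarith)
  have hinit : √(P 0) ≤ (1 + c) * R := by
    refine Real.sqrt_le_iff.2 ⟨by positivity, ?_⟩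
    have h1 : ‖x₀ - xs‖ ^ 2 ≤ R ^ 2 := by gcongr
    have h2 : accA A₀ γ 0 = A₀ := by simp [accA]
    simp only [hP, h.1, h.2.1, h2]
    rw [hA0]
    nlinarith [mul_pos hc (sq_pos_of_pos hR)]
  have hs := sum_div_sq_le hR.le J
  have hs0 : 0 ≤ ∑ i ∈ Finset.range J, R / ((i : ℝ) + 1) ^ 2 :=
    Finset.sum_nonneg fun _ _ => by positivity
  simp only [Real.sq_sqrt (hP0 _)] at hmain
  simp only [hP] at hmain hinit
  refine hmain.trans ?_
  gcongr ?_ ^ 2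
  linarith

end Run

/-! ### Estimates for the parameters and the logarithmic factor -/

section Numeric

theorem pow_one_sub_le_exp {γ : ℝ} (hγ : γ ≤ 1) (k : ℕ) : (1 - γ) ^ k ≤ Real.exp (-(γ * k)) := by
  have h1 := pow_le_pow_left₀ (by linarith) (Real.one_sub_le_exp_neg γ) k
  rwa [← Real.exp_nat_mul, show (k : ℝ) * -γ = -(γ * k) by ring] at h1

/-- This keeps the scaling coefficients `A_k` polynomial in `1 / ε` as long as
`k = O(ln (1 / ε) / γ)`. -/
theorem inv_pow_one_sub_le_exp {γ : ℝ} (hγ0 : 0 ≤ γ) (hγ : γ ≤ 1 / 2) (k : ℕ) :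
    1 / (1 - γ) ^ k ≤ Real.exp (2 * (γ * k)) := by
  have h1 : 1 ≤ (1 - γ) * Real.exp (2 * γ) := by
    have h2 := Real.add_one_le_exp (2 * γ)
    nlinarith
  have h3 := one_le_pow₀ h1 (n := k)
  rw [mul_pow, ← Real.exp_nat_mul, show (k : ℝ) * (2 * γ) = 2 * (γ * k) by ring] at h3
  rw [div_le_iff₀ (pow_pos (by linarith) _)]
  linarith

/-- If the gaps are controlled by `((5 + c) / c) ^ 2 * (1 - γ) ^ k`, then `O((1 / γ) ln (1 / ε))`
iterations suffice for the relative accuracy `ε`. -/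
theorem exists_gap_le {δ : ℕ → ℝ} {A₀ γ G R Δ c ε ℓ : ℝ} (hc : 0 < c) (hR : 0 < R) (hΔ : 0 < Δ)
    (hA0 : 2 * A₀ * Δ = c ^ 2 * R ^ 2) (hγ0 : 0 < γ) (hγ : γ < 1) (hG : γ * G = 1) (hG1 : 1 ≤ G)
    (hℓ : 1 ≤ ℓ) (hε : ε = Real.exp (-ℓ))
    (h : ∀ k, 2 * accA A₀ γ k * δ k ≤ ((5 + c) * R) ^ 2) :
    ∃ k : ℕ, (k : ℝ) ≤ (2 + 2 * Real.log ((5 + c) / c)) * (G * ℓ) ∧ δ k ≤ ε * Δ := by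
  obtain ⟨B, hB⟩ : ∃ B, B = 2 * Real.log ((5 + c) / c) := ⟨_, rfl⟩
  have hratio : 1 ≤ (5 + c) / c := by rw [le_div_iff₀ hc]; linarith
  have hB0 : 0 ≤ B := by rw [hB]; linarith [Real.log_nonneg hratio]
  have hBexp : Real.exp B = ((5 + c) / c) ^ 2 := by
    have : B = (2 : ℕ) * Real.log ((5 + c) / c) := by rw [hB]; norm_num
    rw [this, Real.exp_nat_mul, Real.exp_log (by linarith)]
  have hx : 0 ≤ G * (ℓ + B) := by positivity
  refine ⟨⌈G * (ℓ + B)⌉₊, ?_, ?_⟩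
  · rw [← hB]
    have h1 := (Nat.ceil_lt_add_one hx).le
    have h2 : B * (G * 1) ≤ B * (G * ℓ) := by gcongr
    have h3 : 1 * 1 ≤ G * ℓ := by gcongr
    linarith
  · obtain ⟨k, hk⟩ : ∃ k, k = ⌈G * (ℓ + B)⌉₊ := ⟨_, rfl⟩
    rw [← hk]
    have hkγ : ℓ + B ≤ γ * k := by
      have h1 : G * (ℓ + B) ≤ k := hk ▸ Nat.le_ceil _
      have h2 := mul_le_mul_of_nonneg_left h1 hγ0.le
      rwa [← mul_assoc, hG, one_mul] at h2
    have hpow : 0 < (1 - γ) ^ k := pow_pos (by linarith) _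
    have h1 := h k
    rw [accA] at h1
    have h2 : 2 * A₀ * δ k ≤ ((5 + c) * R) ^ 2 * (1 - γ) ^ k := by
      rw [← div_le_iff₀ hpow]
      calc _ = 2 * (A₀ / (1 - γ) ^ k) * δ k := by ring
        _ ≤ _ := h1
    have h3 : (1 - γ) ^ k ≤ ε / Real.exp B := by
      refine (pow_one_sub_le_exp hγ.le k).trans ?_
      rw [hε, ← Real.exp_sub]
      exact Real.exp_le_exp.2 (by linarith)
    rw [hBexp] at h3
    have h4 : c ^ 2 * R ^ 2 * δ k ≤ c ^ 2 * R ^ 2 * (ε * Δ) := by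
      calc c ^ 2 * R ^ 2 * δ k = (2 * A₀ * δ k) * Δ := by rw [← hA0]; ring
        _ ≤ (((5 + c) * R) ^ 2 * (ε / ((5 + c) / c) ^ 2)) * Δ :=
          mul_le_mul_of_nonneg_right (h2.trans (by gcongr)) hΔ.le
        _ = c ^ 2 * R ^ 2 * (ε * Δ) := by
          have : 5 + c ≠ 0 := by positivity
          field_simp
    exact le_of_mul_le_mul_left h4 (by positivity)

/-- A quantity which is polynomial in `G`, `X`, `exp ℓ` and `ℓ` has a logarithm of the order of
`ln (G X exp ℓ ℓ²)`. -/
theorem log_le_of_le_poly {G X ℓ t D C : ℝ} (hG : 2 ≤ G) (hX : 1 / 2 ≤ X) (hℓ : 1 ≤ ℓ) (hD : 0 < D)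
    (hC : 0 ≤ C) (ht0 : 0 ≤ t) (ht : t ≤ D * Real.exp (2 * (C * ℓ)) * (G * ℓ) ^ 2 * X ^ 2) :
    1 ≤ Real.log (G * X * Real.exp ℓ * ℓ ^ 2) ∧
    max 0 (Real.log t) ≤
      (|Real.log D| + 2 * C + 2) * Real.log (G * X * Real.exp ℓ * ℓ ^ 2) := by
  have hG0 : 0 < G := by linarith
  have hX0 : 0 < X := by linarith
  have hℓ0 : 0 < ℓ := by linarith
  have hlogℓ : 0 ≤ Real.log ℓ := Real.log_nonneg hℓ
  have hGX : 0 ≤ Real.log G + Real.log X := by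
    rw [← Real.log_mul hG0.ne' hX0.ne']
    exact Real.log_nonneg (by nlinarith)
  have hL : Real.log (G * X * Real.exp ℓ * ℓ ^ 2) =
      Real.log G + Real.log X + ℓ + 2 * Real.log ℓ := by
    rw [Real.log_mul (by positivity) (by positivity), Real.log_mul (by positivity) (by positivity),
      Real.log_mul (by positivity) (by positivity), Real.log_exp, Real.log_pow]
    norm_num
  obtain ⟨L, hLdef⟩ : ∃ L, L = Real.log (G * X * Real.exp ℓ * ℓ ^ 2) := ⟨_, rfl⟩
  rw [← hLdef] at hL ⊢
  have hℓL : ℓ ≤ L := by linarith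
  have hL1 : 1 ≤ L := hℓ.trans hℓL
  refine ⟨hL1, max_le (by positivity) ?_⟩
  rcases ht0.eq_or_lt with rfl | htpos
  · rw [Real.log_zero]; positivity
  have h1 := Real.log_le_log htpos ht
  rw [Real.log_mul (by positivity) (by positivity), Real.log_mul (by positivity) (by positivity),
    Real.log_mul (by positivity) (by positivity), Real.log_exp, Real.log_pow, Real.log_pow,
    Real.log_mul (by positivity) (by positivity)] at h1
  push_cast at h1
  have h2 : Real.log D ≤ |Real.log D| * L :=
    (le_abs_self _).trans (le_mul_of_one_le_right (abs_nonneg _) hL1)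
  have h3 : C * ℓ ≤ C * L := by gcongr
  linarith

theorem two_le_rpow {M R : ℝ} (hM : 0 < M) (hMR : (2 : ℝ) ^ ((3 : ℝ) / 2) / M ≤ R) :
    2 ≤ (M * R) ^ ((2 : ℝ) / 3) := by
  rw [div_le_iff₀ hM, mul_comm] at hMR
  have h := Real.rpow_le_rpow (by positivity) hMR (show (0 : ℝ) ≤ 2 / 3 by norm_num)
  rwa [← Real.rpow_mul (by norm_num), show (3 : ℝ) / 2 * (2 / 3) = 1 by norm_num,
    Real.rpow_one] at h

theorem rpow_two_thirds_pow_three {x : ℝ} (hx : 0 ≤ x) : (x ^ ((2 : ℝ) / 3)) ^ 3 = x ^ 2 := by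
  rw [← Real.rpow_natCast, ← Real.rpow_mul hx, ← Real.rpow_natCast]
  norm_num

end Numeric

/-! ### The initial subgradients of the inner calls -/

section Constants

variable {Q : Set E} {f ψ : E → ℝ} {M R r Lf Lψ F₀ : ℝ} {x₀ xs : E}

/-- The gap at `x₀` splits into the Bregman distance of `f`, which is at most both `F₀` and
`L_f R²`, and a linear term, which the subgradients of `ψ` control. -/
theorem gap_le (hf : IsQuasiSelfConcordantOn Q f M) (hψ : ConvexOn ℝ Q ψ) (hxs : xs ∈ Q)
    (hmin : ∀ y ∈ Q, f xs + ψ xs ≤ f y + ψ y)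
    (h₀ : (subdiff Q (fun y => f y + ψ y) x₀).Nonempty) (h0R : ‖x₀ - xs‖ ≤ R) (hRr : R ≤ r)
    (hLf : IsLUB (hessNorms Q f xs r) Lf) (hLψ : IsLUB (subgradNorms Q ψ xs r) Lψ)
    (hF₀ : IsLUB (residuals Q (fun y => f y + ψ y) xs r) F₀) :
    (f x₀ + ψ x₀) - (f xs + ψ xs) ≤ R * (√(Lf * F₀) + 2 * Lψ) := by
  have hR : 0 ≤ R := (norm_nonneg _).trans h0R
  have hs0 : ‖xs - xs‖ ≤ r := by simpa using hR.trans hRr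
  obtain ⟨p, hp⟩ := h₀
  have hx₀ := hp.1
  have hpψ := sub_mem_subdiff hψ (hf.differentiableAt hx₀).hasFDerivAt hp
  have hsψ := sub_mem_subdiff (p := 0) hψ (hf.differentiableAt hxs).hasFDerivAt
    ⟨hxs, fun y hy => by simpa using hmin y hy⟩
  have hp1 : ‖p - fderiv ℝ f x₀‖ ≤ Lψ := hLψ.1 ⟨x₀, hx₀, h0R.trans hRr, _, hpψ, rfl⟩
  have hs1 : ‖0 - fderiv ℝ f xs‖ ≤ Lψ := hLψ.1 ⟨xs, hxs, hs0, _, hsψ, rfl⟩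
  rw [zero_sub, norm_neg] at hs1
  have hF1 : (f x₀ + ψ x₀) - (f xs + ψ xs) ≤ F₀ := hF₀.1 ⟨x₀, hx₀, h0R.trans hRr, rfl⟩
  have hLf0 : 0 ≤ Lf := (norm_nonneg (hess f xs)).trans (hLf.1 ⟨xs, hxs, hs0, rfl⟩)
  have hgrad := hf.norm_fderiv_sub_le hxs hx₀ (L := Lf) fun y hy => by
    have hb : y ∈ Metric.closedBall xs R := (convex_closedBall xs R).segment_subset
      (by simpa using hR) (by simpa [dist_eq_norm] using h0R) hy
    exact hLf.1 ⟨y, hψ.1.segment_subset hxs hx₀ hy,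
      (by simpa [dist_eq_norm] using hb : ‖y - xs‖ ≤ R).trans hRr, rfl⟩
  have hfx := (fderiv_mem_subdiff hf.convexOn hx₀ (hf.differentiableAt hx₀)).2 xs hxs
  have hfs := (fderiv_mem_subdiff hf.convexOn hxs (hf.differentiableAt hxs)).2 x₀ hx₀
  have hψx := hpψ.2 xs hxs
  have hψs := hsψ.2 x₀ hx₀
  rw [← neg_sub x₀ xs, map_neg] at hfx hψx
  rw [zero_sub, neg_apply] at hψs
  obtain ⟨b, hb⟩ : ∃ b, b = f x₀ - f xs - fderiv ℝ f xs (x₀ - xs) := ⟨_, rfl⟩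
  have hb0 : 0 ≤ b := by linarith
  have hbF : b ≤ F₀ := by linarith
  have hbL : b ≤ Lf * R ^ 2 := by
    have h1 := (le_abs_self _).trans
      ((fderiv ℝ f x₀ - fderiv ℝ f xs).le_of_opNorm_le hgrad (x₀ - xs))
    rw [sub_apply] at h1
    have h2 : Lf * ‖x₀ - xs‖ * ‖x₀ - xs‖ ≤ Lf * R * R := by gcongr
    linarith
  have hbs : b ≤ R * √(Lf * F₀) := by
    have h1 : b ≤ √(R ^ 2 * (Lf * F₀)) := Real.le_sqrt_of_sq_le (by
      have := mul_le_mul hbL hbF hb0 (by positivity)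
      linarith)
    rwa [Real.sqrt_mul (sq_nonneg R), Real.sqrt_sq hR] at h1
  have h1 : fderiv ℝ f xs (x₀ - xs) ≤ Lψ * R :=
    (le_abs_self _).trans ((fderiv ℝ f xs).le_of_opNorm_le_of_le hs1 h0R)
  have h2 : (p - fderiv ℝ f x₀) (x₀ - xs) ≤ Lψ * R :=
    (le_abs_self _).trans ((p - fderiv ℝ f x₀).le_of_opNorm_le_of_le hp1 h0R)
  linarith

/-- The negative gradient at the solution is a subgradient of `ψ`, hence bounded by `L_ψ`. -/
theorem norm_fderiv_le (hf : IsQuasiSelfConcordantOn Q f M) (hψ : ConvexOn ℝ Q ψ) (hxs : xs ∈ Q)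
    (hmin : ∀ y ∈ Q, f xs + ψ xs ≤ f y + ψ y) (hr : 0 ≤ r)
    (hLf : IsLUB (hessNorms Q f xs r) Lf) (hLψ : IsLUB (subgradNorms Q ψ xs r) Lψ) {y : E}
    (hy : y ∈ Q) (hyr : ‖y - xs‖ ≤ r) : ‖fderiv ℝ f y‖ ≤ Lψ + Lf * r := by
  have hs0 : ‖xs - xs‖ ≤ r := by simpa using hr
  have hsψ := sub_mem_subdiff (p := 0) hψ (hf.differentiableAt hxs).hasFDerivAt
    ⟨hxs, fun y hy => by simpa using hmin y hy⟩
  have hs1 : ‖0 - fderiv ℝ f xs‖ ≤ Lψ := hLψ.1 ⟨xs, hxs, hs0, _, hsψ, rfl⟩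
  rw [zero_sub, norm_neg] at hs1
  have hLf0 : 0 ≤ Lf := (norm_nonneg (hess f xs)).trans (hLf.1 ⟨xs, hxs, hs0, rfl⟩)
  have hgrad := hf.norm_fderiv_sub_le hxs hy (L := Lf) fun z hz => by
    have hb : z ∈ Metric.closedBall xs r := (convex_closedBall xs r).segment_subset
      (by simpa using hr) (by simpa [dist_eq_norm] using hyr) hz
    exact hLf.1 ⟨z, hψ.1.segment_subset hxs hy hz, by simpa [dist_eq_norm] using hb, rfl⟩
  calc ‖fderiv ℝ f y‖ = ‖fderiv ℝ f xs + (fderiv ℝ f y - fderiv ℝ f xs)‖ := by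
        rw [add_sub_cancel]
    _ ≤ Lψ + Lf * r := (norm_add_le _ _).trans (add_le_add hs1 (hgrad.trans (by gcongr)))

/-- Both terms of `2 L_ψ + L_f (5 + c) R`, relative to `Δ / R`, are at most quadratic in the
quantity `X` under the logarithm. -/
theorem scaled_bound {Δ X c : ℝ} (hc : 0 < c) (hΔ : 0 < Δ) (hR : 0 < R) (hLf : 0 ≤ Lf)
    (hLψ : 0 ≤ Lψ) (hF₀ : Δ ≤ F₀) (hX : X = R / Δ * (√(Lf * F₀) + Lψ))
    (hgap : Δ ≤ R * (√(Lf * F₀) + 2 * Lψ)) :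
    1 / 2 ≤ X ∧ R / Δ * (2 * Lψ + Lf * ((5 + c) * R)) ≤ (9 + c) * X ^ 2 := by
  obtain ⟨s, hs⟩ : ∃ s, s = √(Lf * F₀) := ⟨_, rfl⟩
  have hs0 : 0 ≤ s := hs ▸ Real.sqrt_nonneg _
  have hs2 : s ^ 2 = Lf * F₀ := by rw [hs, Real.sq_sqrt (mul_nonneg hLf (hΔ.le.trans hF₀))]
  rw [← hs] at hX hgap
  have hXmul : X * Δ = R * (s + Lψ) := by rw [hX]; field_simp
  have hX1 : 1 / 2 ≤ X := by
    refine le_of_mul_le_mul_right ?_ hΔ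
    rw [hXmul]
    nlinarith [mul_nonneg hR.le hs0]
  have h1 : R / Δ * Lψ ≤ X := by
    rw [hX]
    gcongr
    linarith
  have h2 : R / Δ * Lf * R ≤ X ^ 2 := by
    have h3 : (R / Δ) ^ 2 * (Lf * Δ) ≤ X ^ 2 := by
      rw [hX, mul_pow]
      gcongr
      calc Lf * Δ ≤ Lf * F₀ := by gcongr
        _ = s ^ 2 := hs2.symm
        _ ≤ _ := by gcongr; linarith
    calc R / Δ * Lf * R = (R / Δ) ^ 2 * (Lf * Δ) := by field_simp
      _ ≤ _ := h3
  refine ⟨hX1, ?_⟩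
  have h4 : X ≤ 2 * X ^ 2 := by nlinarith
  have h5 := mul_le_mul_of_nonneg_left h2 (show 0 ≤ 5 + c by positivity)
  linarith

end Constants

section InnerCall

variable {Q : Set E} {f ψ : E → ℝ} {M R A₀ γ : ℝ} {k : ℕ} {xk vk : E}

/-- An inner call is well defined. -/
theorem existsUnique_innerCallReturns [FiniteDimensional ℝ E] (hf : IsQuasiSelfConcordantOn Q f M)
    (hψ : IsClosedConvexProper Q ψ) (hM : 0 < M) (hR : 0 < R) (hA : 0 < A₀)
    (hγ0 : 0 < γ) (hγ : γ < 1) (hxk : xk ∈ Q) {p : E →L[ℝ] ℝ}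
    (hp : p ∈ subdiff Q (fun y => accSmooth f A₀ γ k xk y + accComposite ψ A₀ γ k vk y) vk) :
    ∃! r : E × ℕ, InnerCallReturns Q f ψ M R A₀ γ k xk vk p r.1 r.2 := by
  have hq := isQuasiSelfConcordantOn_accSmooth (k := k) hf hA hγ0 hγ hxk
  have hsc := strongConvexOn_accComposite (k := k) (vk := vk) hψ.convexOn hA hγ0 hγ
  have hcl := isClosedConvexProper_accComposite (k := k) (vk := vk) hψ hA hγ0 hγ
  obtain ⟨xbar, I, h⟩ := exists_dualNewtonReturns hq (mul_pos hγ0 hM)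
    (show 0 < R / ((k : ℝ) + 1) ^ 2 by positivity) hcl hsc hp
  refine ⟨(xbar, I), h, fun r hr => ?_⟩
  obtain ⟨h1, h2⟩ := DualNewtonReturns.unique hq (mul_pos hγ0 hM) hcl.convexOn hsc hr h
  exact Prod.ext h1 h2

theorem InnerCallReturns.iterations_le [FiniteDimensional ℝ E]
    (hf : IsQuasiSelfConcordantOn Q f M)
    (hψ : IsClosedConvexProper Q ψ) (hM : 0 < M) (hR : 0 < R) (hA : 0 < A₀)
    (hγ0 : 0 < γ) (hγ : γ < 1) (hxk : xk ∈ Q) {p : E →L[ℝ] ℝ} {v' : E} {I : ℕ}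
    (h : InnerCallReturns Q f ψ M R A₀ γ k xk vk p v' I) :
    (I : ℝ) ≤ 1 + 16 * (γ * M) ^ 2 * (‖v' - vk‖ ^ 2 + 26 * (R / ((k : ℝ) + 1) ^ 2) ^ 2) +
      2 * max 0 (Real.log (‖p‖ / (R / ((k : ℝ) + 1) ^ 2))) :=
  DualNewtonReturns.iterations_le (isQuasiSelfConcordantOn_accSmooth (k := k) hf hA hγ0 hγ hxk)
    (mul_pos hγ0 hM) (by positivity) (isClosedConvexProper_accComposite hψ hA hγ0 hγ)
    (strongConvexOn_accComposite hψ.convexOn hA hγ0 hγ) h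

/-- Bound on the initial subgradient of an inner call, relative to its tolerance. -/
theorem InnerCallReturns.norm_subgradient_le (hf : IsQuasiSelfConcordantOn Q f M)
    (hψ : ConvexOn ℝ Q ψ) (hR : 0 < R) (hA : 0 < A₀) (hγ0 : 0 < γ) (hγ : γ ≤ 1 / 2) {xs : E}
    (hxs : xs ∈ Q) (hmin : ∀ y ∈ Q, f xs + ψ xs ≤ f y + ψ y) {r Lf Lψ : ℝ}
    (hLf : IsLUB (hessNorms Q f xs r) Lf) (hLψ : IsLUB (subgradNorms Q ψ xs r) Lψ)
    (hxk : xk ∈ Q) (hxr : ‖xk - xs‖ ≤ r) (hvr : ‖vk - xs‖ ≤ r)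
    {p : E →L[ℝ] ℝ} {v' : E} {I : ℕ} (h : InnerCallReturns Q f ψ M R A₀ γ k xk vk p v' I)
    {K : ℕ} (hkK : k + 1 ≤ K) :
    ‖p‖ / (R / ((k : ℝ) + 1) ^ 2) ≤
      A₀ * Real.exp (2 * (γ * K)) * (2 * Lψ + Lf * r) * (K : ℝ) ^ 2 / R := by
  have hγ1 : γ < 1 := by linarith
  have hr : 0 ≤ r := (norm_nonneg _).trans hxr
  obtain ⟨q, hq, hpq⟩ := exists_subdiff_of_subproblem hf hψ hA hγ0 hγ1 hxk h.1
  have hy : γ • vk + (1 - γ) • xk ∈ Q ∩ Metric.closedBall xs r :=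
    convex_comb_mem (hψ.1.inter (convex_closedBall xs r)) hγ0 hγ1
      ⟨hq.1, by simpa [dist_eq_norm] using hvr⟩ ⟨hxk, by simpa [dist_eq_norm] using hxr⟩
  have h1 := norm_fderiv_le hf hψ hxs hmin hr hLf hLψ hy.1
    (by simpa [dist_eq_norm] using hy.2)
  have h2 : ‖q‖ ≤ Lψ := hLψ.1 ⟨vk, hq.1, hvr, q, hq, rfl⟩
  have hA' := accA_pos hA hγ1 (k + 1)
  have h3 : ‖p‖ ≤ accA A₀ γ (k + 1) * (2 * Lψ + Lf * r) := by
    have h4 : ‖fderiv ℝ f (γ • vk + (1 - γ) • xk) + q‖ ≤ 2 * Lψ + Lf * r :=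
      (norm_add_le _ _).trans (by linarith)
    rw [hpq, sub_self, map_zero, add_zero, norm_smul, Real.norm_of_nonneg (by positivity)]
    gcongr
    nlinarith
  have hkK' : (k : ℝ) + 1 ≤ K := by exact_mod_cast hkK
  have h5 : accA A₀ γ (k + 1) ≤ A₀ * Real.exp (2 * (γ * K)) := by
    rw [accA, div_eq_mul_one_div]
    gcongr
    refine (inv_pow_one_sub_le_exp hγ0.le hγ _).trans (Real.exp_le_exp.2 ?_)
    push_cast
    gcongr
  have h6 : 0 ≤ 2 * Lψ + Lf * r := by
    linarith [norm_nonneg (fderiv ℝ f (γ • vk + (1 - γ) • xk)), norm_nonneg q]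
  rw [div_div_eq_mul_div]
  gcongr
  exact h3.trans (by gcongr)

end InnerCall

/-- In a run, the iterates `x_k` and `v_k` stay within the distance `(5 + c) R` of the solution. -/
theorem norm_sub_le_of_run {xs : E} {x v : ℕ → E} {γ r : ℝ} (hγ0 : 0 < γ) (hγ : γ < 1)
    (hx0 : ‖x 0 - xs‖ ≤ r) (hv : ∀ k, ‖v k - xs‖ ≤ r)
    (hx : ∀ k, x (k + 1) = γ • v (k + 1) + (1 - γ) • x k) (k : ℕ) : ‖x k - xs‖ ≤ r := by
  induction k with
  | zero => exact hx0
  | succ k ih =>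
    have := convex_comb_mem (convex_closedBall xs r) hγ0 hγ
      (show v (k + 1) ∈ Metric.closedBall xs r by simpa [dist_eq_norm] using hv (k + 1))
      (show x k ∈ Metric.closedBall xs r by simpa [dist_eq_norm] using ih)
    rw [hx]
    simpa [dist_eq_norm] using this

/-! ### Complexity of the accelerated scheme -/

section Complexity

variable {Q : Set E} {f ψ : E → ℝ} {M R A₀ γ : ℝ} {x₀ xs : E} {x v : ℕ → E} {I : ℕ → ℕ}

/-- Total number of Dual Newton iterations in the first `K` inner calls, given a bound `T` for the
logarithms: the contributions of the displacements `v_{k+1} - v_k` are summable. -/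
theorem IsAcceleratedNewtonRun.sum_iterations_le [FiniteDimensional ℝ E]
    (hf : IsQuasiSelfConcordantOn Q f M) (hψ : IsClosedConvexProper Q ψ) (hM : 0 < M) (hR : 0 < R)
    (hA : 0 < A₀) (hγ0 : 0 < γ) (hγ : γ < 1)
    (h₀ : (subdiff Q (fun y => f y + ψ y) x₀).Nonempty)
    (h : IsAcceleratedNewtonRun Q f ψ M R A₀ γ x₀ ⊤ x v I) {K : ℕ} {T S : ℝ}
    (hS : ∑ i ∈ Finset.range K, ‖v (i + 1) - v i‖ ^ 2 ≤ S)
    (hT : ∀ i < K, ∀ p, InnerCallReturns Q f ψ M R A₀ γ i (x i) (v i) p (v (i + 1)) (I i) →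
      max 0 (Real.log (‖p‖ / (R / ((i : ℝ) + 1) ^ 2))) ≤ T) :
    ∑ i ∈ Finset.range K, (I i : ℝ) ≤ K + 16 * (γ * M) ^ 2 * (S + 52 * R ^ 2) + 2 * K * T := by
  have hle : ∀ i ∈ Finset.range K, (I i : ℝ) ≤ (1 + 2 * T) +
      16 * (γ * M) ^ 2 * (‖v (i + 1) - v i‖ ^ 2 + 26 * (R / ((i : ℝ) + 1) ^ 2) ^ 2) := by
    intro i hi
    obtain ⟨⟨p, hp⟩, -⟩ := h.2.2 i (ENat.natCast_lt_top i)
    have h1 := hp.iterations_le hf hψ hM hR hA hγ0 hγ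
      (h.mem hf hψ.convexOn hA hγ0 hγ h₀ i le_top).1
    have h2 := hT i (Finset.mem_range.1 hi) p hp
    linarith
  refine (Finset.sum_le_sum hle).trans ?_
  simp only [Finset.sum_add_distrib, ← Finset.mul_sum, Finset.sum_const, Finset.card_range,
    nsmul_eq_mul]
  have h3 := sum_div_sq_sq_le (c := R) K
  have h4 : 16 * (γ * M) ^ 2 * (∑ i ∈ Finset.range K, ‖v (i + 1) - v i‖ ^ 2 +
      26 * ∑ i ∈ Finset.range K, (R / ((i : ℝ) + 1) ^ 2) ^ 2) ≤
      16 * (γ * M) ^ 2 * (S + 52 * R ^ 2) :=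
    mul_le_mul_of_nonneg_left (by linarith) (by positivity)
  linarith

/-- The logarithms that bound the inner calls are of the order of the logarithmic factor. -/
theorem IsAcceleratedNewtonRun.log_subgradient_le
    (hf : IsQuasiSelfConcordantOn Q f M) (hψ : ConvexOn ℝ Q ψ)
    (hxs : xs ∈ Q) (hmin : ∀ y ∈ Q, f xs + ψ xs ≤ f y + ψ y)
    (h₀ : (subdiff Q (fun y => f y + ψ y) x₀).Nonempty)
    (h : IsAcceleratedNewtonRun Q f ψ M R A₀ γ x₀ ⊤ x v I)
    {c C ε ℓ Δ Lf Lψ F₀ : ℝ} (hc : 0 < c) (hC : 0 < C) (hR : 0 < R) (h0R : ‖x₀ - xs‖ ≤ R)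
    (hΔ : 0 < Δ) (hΔdef : Δ = (f x₀ + ψ x₀) - (f xs + ψ xs)) (hA0 : 2 * A₀ * Δ = c ^ 2 * R ^ 2)
    (hG : 2 ≤ (M * R) ^ ((2 : ℝ) / 3)) (hγ : γ = 1 / (M * R) ^ ((2 : ℝ) / 3))
    (hε : 0 < ε) (hℓ : 1 ≤ ℓ) (hℓdef : ℓ = Real.log (1 / ε)) {K : ℕ}
    (hK : (K : ℝ) ≤ C * ((M * R) ^ ((2 : ℝ) / 3) * ℓ))
    (hLf : IsLUB (hessNorms Q f xs ((5 + c) * R)) Lf)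
    (hLψ : IsLUB (subgradNorms Q ψ xs ((5 + c) * R)) Lψ)
    (hF₀ : IsLUB (residuals Q (fun y => f y + ψ y) xs ((5 + c) * R)) F₀) :
    1 ≤ logFactor M R Δ Lf Lψ F₀ ε ∧
    ∀ i < K, ∀ p, InnerCallReturns Q f ψ M R A₀ γ i (x i) (v i) p (v (i + 1)) (I i) →
      max 0 (Real.log (‖p‖ / (R / ((i : ℝ) + 1) ^ 2))) ≤
        (|Real.log (c ^ 2 / 2 * C ^ 2 * (9 + c))| + 2 * C + 2) *
          logFactor M R Δ Lf Lψ F₀ ε := by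
  obtain ⟨G, hGdef⟩ : ∃ G, G = (M * R) ^ ((2 : ℝ) / 3) := ⟨_, rfl⟩
  rw [← hGdef] at hG hγ hK
  have hG0 : 0 < G := by linarith
  have hγ0 : 0 < γ := hγ ▸ by positivity
  have hγ2 : γ ≤ 1 / 2 := by rw [hγ]; gcongr
  have hγ1 : γ < 1 := by linarith
  have hA : 0 < A₀ := by
    have : 0 < 2 * A₀ * Δ := hA0 ▸ by positivity
    have := pos_of_mul_pos_left this hΔ.le
    linarith
  have hr : R ≤ (5 + c) * R := by nlinarith
  have hpot := h.potential_le hf hψ hA hγ0 hγ1 hR h₀ hxs hmin hc h0R (hΔdef ▸ hA0)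
  have hv : ∀ k, ‖v k - xs‖ ≤ (5 + c) * R := fun k => by
    have h1 := accA_pos hA hγ1 k
    have h2 := sub_nonneg.2 (hmin _ (h.mem hf hψ hA hγ0 hγ1 h₀ k le_top).1)
    have h3 := Finset.sum_nonneg fun i (_ : i ∈ Finset.range k) => sq_nonneg ‖v (i + 1) - v i‖
    refine (pow_le_pow_iff_left₀ (norm_nonneg _) (by positivity) two_ne_zero).1 ?_
    have : 0 ≤ 2 * accA A₀ γ k * ((f (x k) + ψ (x k)) - (f xs + ψ xs)) := by positivity
    linarith [hpot k]
  have hx := norm_sub_le_of_run hγ0 hγ1 (by rw [h.1]; exact h0R.trans hr) hv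
    fun k => (h.2.2 k (ENat.natCast_lt_top k)).2
  have hs0 : ‖xs - xs‖ ≤ (5 + c) * R := by simp; positivity
  have hLf0 : 0 ≤ Lf := (norm_nonneg (hess f xs)).trans (hLf.1 ⟨xs, hxs, hs0, rfl⟩)
  have hx₀ : x₀ ∈ Q := h₀.choose_spec.1
  have hLψ0 : 0 ≤ Lψ := by
    obtain ⟨p, hp⟩ := h₀
    have h1 := sub_mem_subdiff hψ (hf.differentiableAt hp.1).hasFDerivAt hp
    exact (norm_nonneg (p - fderiv ℝ f x₀)).trans
      (hLψ.1 ⟨x₀, hx₀, h0R.trans hr, _, h1, rfl⟩)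
  have hΔF : Δ ≤ F₀ := hF₀.1 ⟨x₀, hx₀, h0R.trans hr, hΔdef⟩
  obtain ⟨X, hX⟩ : ∃ X, X = R / Δ * (√(Lf * F₀) + Lψ) := ⟨_, rfl⟩
  obtain ⟨hX1, hX2⟩ := scaled_bound hc hΔ hR hLf0 hLψ0 hΔF hX
    (hΔdef ▸ gap_le hf hψ hxs hmin h₀ h0R hr hLf hLψ hF₀)
  have hL : logFactor M R Δ Lf Lψ F₀ ε = Real.log (G * X * Real.exp ℓ * ℓ ^ 2) := by
    rw [logFactor, hℓdef, Real.exp_log (by positivity), hX, ← hGdef]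
    congr 1
    ring
  rw [hL]
  have hD : 0 < c ^ 2 / 2 * C ^ 2 * (9 + c) := by positivity
  refine ⟨(log_le_of_le_poly hG hX1 hℓ hD hC.le le_rfl (by positivity)).1, fun i hi p hp => ?_⟩
  refine (log_le_of_le_poly hG hX1 hℓ hD hC.le (by positivity) ?_).2
  refine (hp.norm_subgradient_le hf hψ hR hA hγ0 hγ2 hxs hmin hLf hLψ
    (h.mem hf hψ hA hγ0 hγ1 h₀ i le_top).1 (hx i) (hv i) (K := K) hi).trans ?_
  have hγK : γ * K ≤ C * ℓ := by
    calc γ * K ≤ γ * (C * (G * ℓ)) := by gcongr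
      _ = C * ℓ := by rw [hγ]; field_simp
  have hA0' : A₀ / R = c ^ 2 / 2 * (R / Δ) := by
    field_simp
    linarith
  calc A₀ * Real.exp (2 * (γ * K)) * (2 * Lψ + Lf * ((5 + c) * R)) * (K : ℝ) ^ 2 / R
      = (A₀ / R) * (2 * Lψ + Lf * ((5 + c) * R)) * Real.exp (2 * (γ * K)) * (K : ℝ) ^ 2 := by
        ring
    _ = c ^ 2 / 2 * (R / Δ * (2 * Lψ + Lf * ((5 + c) * R))) * Real.exp (2 * (γ * K)) *
        (K : ℝ) ^ 2 := by rw [hA0']; ring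
    _ ≤ c ^ 2 / 2 * ((9 + c) * X ^ 2) * Real.exp (2 * (C * ℓ)) * (C * (G * ℓ)) ^ 2 := by gcongr
    _ = _ := by ring

end Complexity

end QSCNewton

theorem mainTheorem2 (c : ℝ) (hc : 0 < c) :
    ∃ C : ℝ, 0 < C ∧
      ∀ (E : Type u) [NormedAddCommGroup E] [InnerProductSpace ℝ E] [FiniteDimensional ℝ E]
        (Q : Set E) (f ψ : E → ℝ) (M R A₀ γ : ℝ) (x₀ xs : E),
        -- the problem `min_{x ∈ Q} F(x)`, `F = f + ψ`, with solution `xs`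
        0 < M →
        QSCNewton.IsQuasiSelfConcordantOn Q f M →
        QSCNewton.IsClosedConvexProper Q ψ →
        xs ∈ Q → (∀ y ∈ Q, f xs + ψ xs ≤ f y + ψ y) →
        -- the initial point
        x₀ ∈ Q → f xs + ψ xs < f x₀ + ψ x₀ →
        (QSCNewton.subdiff Q (fun y => f y + ψ y) x₀).Nonempty →
        -- the parameters
        max ‖x₀ - xs‖ ((2 : ℝ) ^ ((3 : ℝ) / 2) / M) ≤ R →
        A₀ = c ^ 2 * R ^ 2 / (2 * ((f x₀ + ψ x₀) - (f xs + ψ xs))) →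
        γ = 1 / (M * R) ^ ((2 : ℝ) / 3) →
        -- the scheme never gets stuck: after any number of iterations, the next inner call can be
        -- initialized, and for every initialization it terminates, with a unique result
        (∀ (n : ℕ) (x v : ℕ → E) (I : ℕ → ℕ),
          QSCNewton.IsAcceleratedNewtonRun Q f ψ M R A₀ γ x₀ n x v I →
          (QSCNewton.subdiff Q (fun y => QSCNewton.accSmooth f A₀ γ n (x n) y +
            QSCNewton.accComposite ψ A₀ γ n (v n) y) (v n)).Nonempty ∧
          ∀ p ∈ QSCNewton.subdiff Q (fun y => QSCNewton.accSmooth f A₀ γ n (x n) y +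
            QSCNewton.accComposite ψ A₀ γ n (v n) y) (v n),
            ∃! r : E × ℕ,
              QSCNewton.InnerCallReturns Q f ψ M R A₀ γ n (x n) (v n) p r.1 r.2) ∧
        -- the complexity bounds; `k` is the number of iterations to reach `ε`-accuracy
        (∀ (x v : ℕ → E) (I : ℕ → ℕ),
          QSCNewton.IsAcceleratedNewtonRun Q f ψ M R A₀ γ x₀ ⊤ x v I →
          ∀ ε : ℝ, 0 < ε → ε ≤ Real.exp (-1) →
          ∃ k : ℕ,
            IsLeast {j : ℕ | (f (x j) + ψ (x j)) - (f xs + ψ xs) ≤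
              ε * ((f x₀ + ψ x₀) - (f xs + ψ xs))} k ∧
            (k : ℝ) ≤ C * ((M * R) ^ ((2 : ℝ) / 3) * Real.log (1 / ε)) ∧
            ∀ Lf Lψ F₀ : ℝ,
              IsLUB (QSCNewton.hessNorms Q f xs ((5 + c) * R)) Lf →
              IsLUB (QSCNewton.subgradNorms Q ψ xs ((5 + c) * R)) Lψ →
              IsLUB (QSCNewton.residuals Q (fun y => f y + ψ y) xs ((5 + c) * R)) F₀ →
              (∑ i ∈ Finset.range k, (I i : ℝ)) ≤
                C * ((M * R) ^ ((2 : ℝ) / 3) * Real.log (1 / ε) *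
                  QSCNewton.logFactor M R ((f x₀ + ψ x₀) - (f xs + ψ xs)) Lf Lψ F₀ ε)) := by
  obtain ⟨C₁, hC₁def⟩ : ∃ C₁, C₁ = 2 + 2 * Real.log ((5 + c) / c) := ⟨_, rfl⟩
  have hC₁ : 0 < C₁ := by
    have : 1 ≤ (5 + c) / c := by rw [le_div_iff₀ hc]; linarith
    linarith [Real.log_nonneg this]
  obtain ⟨C₂, hC₂def⟩ :
    ∃ C₂, C₂ = |Real.log (c ^ 2 / 2 * C₁ ^ 2 * (9 + c))| + 2 * C₁ + 2 := ⟨_, rfl⟩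
  have hC₂ : 0 < C₂ := by rw [hC₂def]; positivity
  refine ⟨C₁ + 16 * ((5 + c) ^ 2 + 52) + 2 * C₁ * C₂, by positivity, ?_⟩
  intro E _ _ _ Q f ψ M R A₀ γ x₀ xs hM hf hψ hxs hmin hx₀ hgap h₀ hmax hA₀ hγ
  have h0R : ‖x₀ - xs‖ ≤ R := (le_max_left _ _).trans hmax
  have hMR := (le_max_right _ _).trans hmax
  have hR : 0 < R := lt_of_lt_of_le (by positivity) hMR
  have hG := QSCNewton.two_le_rpow hM hMR
  have hG3 := QSCNewton.rpow_two_thirds_pow_three (mul_pos hM hR).le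
  obtain ⟨Δ, hΔdef⟩ : ∃ Δ, Δ = (f x₀ + ψ x₀) - (f xs + ψ xs) := ⟨_, rfl⟩
  have hΔ : 0 < Δ := by linarith
  obtain ⟨G, hGdef⟩ : ∃ G, G = (M * R) ^ ((2 : ℝ) / 3) := ⟨_, rfl⟩
  simp only [← hΔdef, ← hGdef] at hA₀ hγ hG hG3 ⊢
  have hG0 : 0 < G := by linarith
  have hγ0 : 0 < γ := hγ ▸ by positivity
  have hγ1 : γ < 1 := by rw [hγ, div_lt_one hG0]; linarith
  have hγG : γ * G = 1 := by rw [hγ]; field_simp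
  have hA : 0 < A₀ := hA₀ ▸ by positivity
  have hA0 : 2 * A₀ * Δ = c ^ 2 * R ^ 2 := by rw [hA₀]; field_simp
  refine ⟨fun n x v I h => ?_, fun x v I h ε hε hεe => ?_⟩
  · obtain ⟨hxn, hvn⟩ := h.mem hf hψ.convexOn hA hγ0 hγ1 h₀ n le_rfl
    exact ⟨QSCNewton.subproblem_subdiff_nonempty hf hA hγ0 hγ1 hxn hvn, fun p hp =>
      QSCNewton.existsUnique_innerCallReturns hf hψ hM hR hA hγ0 hγ1 hxn hp⟩
  obtain ⟨ℓ, hℓdef⟩ : ∃ ℓ, ℓ = Real.log (1 / ε) := ⟨_, rfl⟩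
  have hℓ : 1 ≤ ℓ := by
    rw [hℓdef, one_div, Real.log_inv, le_neg]
    exact (Real.log_le_iff_le_exp hε).2 hεe
  have hεℓ : ε = Real.exp (-ℓ) := by
    rw [hℓdef, one_div, Real.log_inv, neg_neg, Real.exp_log hε]
  have hpot := h.potential_le hf hψ.convexOn hA hγ0 hγ1 hR h₀ hxs hmin hc h0R (hΔdef ▸ hA0)
  have hnn : ∀ k, 0 ≤ 2 * QSCNewton.accA A₀ γ k * ((f (x k) + ψ (x k)) - (f xs + ψ xs)) := by
    intro k
    have h1 := QSCNewton.accA_pos hA hγ1 k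
    have h2 := sub_nonneg.2 (hmin _ (h.mem hf hψ.convexOn hA hγ0 hγ1 h₀ k le_top).1)
    positivity
  obtain ⟨k₀, hk₀, hk₀ε⟩ := QSCNewton.exists_gap_le
    (δ := fun k => (f (x k) + ψ (x k)) - (f xs + ψ xs)) hc hR hΔ hA0 hγ0 hγ1 hγG
    (by linarith) hℓ hεℓ fun k => by
      have h3 := Finset.sum_nonneg fun i (_ : i ∈ Finset.range k) => sq_nonneg ‖v (i + 1) - v i‖
      linarith [hpot k, sq_nonneg ‖v k - xs‖]
  rw [← hC₁def] at hk₀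
  classical
  have hex : ∃ k, (f (x k) + ψ (x k)) - (f xs + ψ xs) ≤ ε * Δ := ⟨k₀, hk₀ε⟩
  obtain ⟨K, hKdef⟩ : ∃ K, K = Nat.find hex := ⟨_, rfl⟩
  have hK : (K : ℝ) ≤ C₁ * (G * ℓ) := by
    have : (K : ℝ) ≤ k₀ := by exact_mod_cast hKdef ▸ Nat.find_min' hex hk₀ε
    exact this.trans hk₀
  have hGℓ : 0 < G * ℓ := by positivity
  rw [← hℓdef]
  refine ⟨K, ⟨hKdef ▸ Nat.find_spec hex, fun j hj => hKdef ▸ Nat.find_min' hex hj⟩, ?_, ?_⟩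
  · refine hK.trans ?_
    gcongr
    have : 0 ≤ 2 * C₁ * C₂ := by positivity
    nlinarith [sq_nonneg (5 + c)]
  intro Lf Lψ F₀ hLf hLψ hF₀
  obtain ⟨hL1, hT⟩ := h.log_subgradient_le hf hψ.convexOn hxs hmin h₀ hc hC₁ hR h0R hΔ hΔdef hA0
    (hGdef ▸ hG) (hGdef ▸ hγ) hε hℓ hℓdef (hGdef ▸ hK) hLf hLψ hF₀
  rw [← hC₂def] at hT
  obtain ⟨L, hL⟩ : ∃ L, L = QSCNewton.logFactor M R Δ Lf Lψ F₀ ε := ⟨_, rfl⟩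
  rw [← hL] at hL1 hT ⊢
  have hsum := h.sum_iterations_le (S := ((5 + c) * R) ^ 2) hf hψ hM hR hA hγ0 hγ1 h₀
    (by linarith [hpot K, hnn K, sq_nonneg ‖v K - xs‖]) hT
  refine hsum.trans ?_
  -- the choice of `γ` balances the two contributions: `(γ M R)² = 1 / γ`
  have hbal : (γ * M) ^ 2 * R ^ 2 = G := by
    calc (γ * M) ^ 2 * R ^ 2 = γ ^ 2 * (M * R) ^ 2 := by ring
      _ = (γ * G) ^ 2 * G := by rw [← hG3]; ring
      _ = G := by rw [hγG]; ring
  have e1 : 16 * (γ * M) ^ 2 * (((5 + c) * R) ^ 2 + 52 * R ^ 2) =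
      16 * ((5 + c) ^ 2 + 52) * G := by rw [← hbal]; ring
  have hKL : (K : ℝ) ≤ C₁ * (G * ℓ * L) := by
    calc (K : ℝ) ≤ C₁ * (G * ℓ) := hK
      _ ≤ C₁ * (G * ℓ * L) :=
        mul_le_mul_of_nonneg_left (le_mul_of_one_le_right hGℓ.le hL1) hC₁.le
  have hGL : G ≤ G * ℓ * L :=
    (le_mul_of_one_le_right hG0.le hℓ).trans (le_mul_of_one_le_right hGℓ.le hL1)
  calc (K : ℝ) + 16 * (γ * M) ^ 2 * (((5 + c) * R) ^ 2 + 52 * R ^ 2) + 2 * K * (C₂ * L)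
      ≤ C₁ * (G * ℓ * L) + 16 * ((5 + c) ^ 2 + 52) * (G * ℓ * L) +
        2 * (C₁ * (G * ℓ)) * (C₂ * L) := by rw [e1]; gcongr
    _ = _ := by ring
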